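/- Let $n,m,k$ be nonnegative integers. The following three sets are pairwise in bijection. 1. $\mathcal H^{(k)}_{n,m}$: the hesitating tableaux of length $2n$ with height at most $k$ that end in the one-row shape $(m)$ (with $(0)=\emptyset$). These are the sequences $\emptyset=\lambda^0,\lambda^1,\dots,\lambda^{2n}=(m)$ of Ferrers diagrams, each with at most $k$ rows, such that for every $0\le i<n$ the passage $\lambda^{2i}\to\lambda^{2i+1}\to\lambda^{2i+2}$ is of one of the forms: do nothing, then add a box; remove a box, then do nothing; add a box, then remove a box. 2. $\mathcal L^{(k)}_{n,m}$: the $W_k$-hesitating lattice walks of length $2n$ from $\delta=(k,k-1,\dots,1)$ to $\delta+m e_1=(m+k,k-1,\dots,1)$. These are the walks all of whose points lie in $W_k=\{(x_1,\dots,x_k)\in\mathbb Z^k: x_1>x_2>\dots>x_k>0\}$ and whose steps come in consecutive pairs of the following forms, with $1\le i,j\le k$: a stay step followed by a step $e_i$; a step $-e_i$ followed by a stay step; a step $e_i$ followed by a step $-e_j$. (For $k=0$ there is no vector $e_1$, and the set is taken to be empty if $m>0$.) 3. $\Omega^{(k)}_{n,m}$: the open partition diagrams on the vertices $1,\dots,n$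 with exactly $m$ open arcs that contain no enhanced $(k+1)$-nesting and no future enhanced $(k+1)$-nesting. An open partition diagram consists of closed arcs $(i,j)$ with $1\le i<j\le n$ and open arcs, which have only a left endpoint $i\in\{1,\dots,n\}$, such that every vertex is the left endpoint of at most one arc (closed or open) and the right endpoint of at most one closed arc. An enhanced $l$-nesting consists of $l$ pairs $(i_1,j_1),\dots,(i_l,j_l)$ with $i_1<\dots<i_l\le j_l<\dots<j_1$, each of which is a closed arc or a loop $(v,v)$ at a vertex $v$ that is an endpoint of no arc, closed or open. A future enhanced $(l+1)$-nesting consists of an open arc and an enhanced $l$-nesting such that the left endpoint of the open arc is strictly smaller than all left endpoints of the nesting (for $l=0$: just an open arc). -/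

import Mathlib

namespace Hesitating

/-- A sequence `s 0, s 1, …, s (2n)` is hesitating with respect to a relation `up` (read `up x y`
as "`y` arises from `x` by an elementary increase", so that `up y x` says that `y` arises from `x`
by an elementary decrease) if each of its `n` consecutive pairs of moves is of one of the forms
(i) do nothing, then increase; (ii) decrease, then do nothing; (iii) increase, then decrease. -/
def IsHesitating {α : Type} (up : α → α → Prop) {n : ℕ} (s : Fin (2 * n + 1) → α) : Prop :=
  ∀ i : Fin n,
    let x := s ⟨2 * i, by omega⟩
    let y := s ⟨2 * i + 1, by omega⟩
    let z := s ⟨2 * i + 2, by omega⟩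
    (y = x ∧ up y z) ∨ (up y x ∧ z = y) ∨ (up x y ∧ up z y)

/-! ### Tableaux -/

/-- The Ferrers diagram `μ` arises from `l` by adding one box. -/
def AddBox (l μ : YoungDiagram) : Prop :=
  ∃ c : ℕ × ℕ, c ∉ l.cells ∧ μ.cells = insert c l.cells

/-- Hesitating tableaux of length `2n`, starting at the empty shape, all of whose shapes have at
most `k` rows (`colLen 0` is the length of the first column), ending in the one-row shape `(m)`. -/
def tableaux (k n m : ℕ) : Set (Fin (2 * n + 1) → YoungDiagram) :=
  {s | IsHesitating AddBox s ∧ s 0 = ⊥ ∧ (∀ i, (s i).colLen 0 ≤ k) ∧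
    (s (Fin.last (2 * n))).cells = {0} ×ˢ Finset.range m}

/-! ### Lattice walks -/

/-- The region `x₁ > x₂ > ⋯ > x_k > 0` of `ℤ^k`. -/
def chamber (k : ℕ) : Set (Fin k → ℤ) :=
  {x | StrictAnti x ∧ ∀ i, 0 < x i}

/-- The point `δ = (k, k - 1, …, 1)`. -/
def delta (k : ℕ) : Fin k → ℤ := fun i => (k : ℤ) - (i : ℕ)

/-- The lattice point `y` arises from `x` by a step `e_i`. -/
def UnitStep {k : ℕ} (x y : Fin k → ℤ) : Prop :=
  ∃ i : Fin k, y = x + Pi.single i 1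

/-- `x = δ + m e₁ = (m + k, k - 1, …, 1)`. The vector `e₁` exists only for `k > 0`; for `k = 0`
the only such point is `δ`, with `m = 0`. -/
def IsEndpoint (k m : ℕ) (x : Fin k → ℤ) : Prop :=
  (m = 0 ∧ x = delta k) ∨ ∃ h : 0 < k, x = delta k + Pi.single ⟨0, h⟩ (m : ℤ)

/-- Hesitating lattice walks of length `2n` in the chamber, from `δ` to `δ + m e₁`, given by the
sequence of their points. -/
def walks (k n m : ℕ) : Set (Fin (2 * n + 1) → Fin k → ℤ) :=
  {w | IsHesitating UnitStep w ∧ (∀ i, w i ∈ chamber k) ∧ w 0 = delta k ∧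
    IsEndpoint k m (w (Fin.last (2 * n)))}

/-! ### Open partition diagrams -/

/-- An open partition diagram on the vertices `0 < 1 < ⋯ < n - 1`: closed arcs `(i, j)` with
`i < j`, and open arcs, which have a left endpoint only. Each vertex is the left endpoint of at
most one arc, closed or open, and the right endpoint of at most one closed arc. (The closed arcs
alone thus form the arc diagram of a set partition, whose blocks are the maximal chains
`a₁ < a₂ < ⋯ < a_j` of arcs `(a₁, a₂), …, (a_{j-1}, a_j)`, and an open arc can only start at the
largest element of a block.) -/
@[ext]
structure OpenPartitionDiagram (n : ℕ) where
  arcs : Finset (Fin n × Fin n)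
  openArcs : Finset (Fin n)
  lt_of_mem : ∀ i j, (i, j) ∈ arcs → i < j
  left_unique : ∀ i j j', (i, j) ∈ arcs → (i, j') ∈ arcs → j = j'
  right_unique : ∀ i i' j, (i, j) ∈ arcs → (i', j) ∈ arcs → i = i'
  not_mem_openArcs : ∀ i j, (i, j) ∈ arcs → i ∉ openArcs

namespace OpenPartitionDiagram

variable {n : ℕ} (D : OpenPartitionDiagram n)

/-- A vertex that is an endpoint of no arc, closed or open. -/
def IsIsolated (v : Fin n) : Prop :=
  v ∉ D.openArcs ∧ ∀ u, (v, u) ∉ D.arcs ∧ (u, v) ∉ D.arcs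

/-- The arcs that take part in enhanced nestings: the closed arcs, and a loop `(v, v)` at each
isolated vertex `v`. -/
def EnhancedArc (i j : Fin n) : Prop :=
  (i, j) ∈ D.arcs ∨ (i = j ∧ D.IsIsolated i)

/-- The arcs `(a t, b t)` form an enhanced `l`-nesting
`a₁ < a₂ < ⋯ < a_l ≤ b_l < ⋯ < b₂ < b₁`. -/
def IsEnhancedNesting {l : ℕ} (a b : Fin l → Fin n) : Prop :=
  StrictMono a ∧ StrictAnti b ∧ ∀ t, a t ≤ b t ∧ D.EnhancedArc (a t) (b t)

/-- `D` contains an enhanced `l`-nesting. -/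
def HasEnhancedNesting (l : ℕ) : Prop :=
  ∃ a b : Fin l → Fin n, D.IsEnhancedNesting a b

/-- `D` contains a future enhanced `(l + 1)`-nesting: an open arc whose left endpoint is to the
left of an enhanced `l`-nesting. -/
def HasFutureEnhancedNestingSucc (l : ℕ) : Prop :=
  ∃ o ∈ D.openArcs, ∃ a b : Fin l → Fin n, D.IsEnhancedNesting a b ∧ ∀ t, o < a t

end OpenPartitionDiagram

/-- Open partition diagrams on `n` vertices with `m` open arcs, with neither an enhanced
`(k + 1)`-nesting nor a future enhanced `(k + 1)`-nesting. -/
def openDiagrams (k n m : ℕ) : Set (OpenPartitionDiagram n) :=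
  {D | D.openArcs.card = m ∧ ¬ D.HasEnhancedNesting (k + 1) ∧
    ¬ D.HasFutureEnhancedNestingSucc k}

end Hesitating

/-!
Tableaux correspond to walks via `λ ↦ λ + δ`.

For tableaux and diagrams, fix the form of each pair of moves of the tableau and let it prescribe
the role of the corresponding vertex of the diagram: a stay and an increase make it a left endpoint
only, a decrease and a stay a right endpoint only, an increase and a decrease both (possibly of a
loop). This yields a word in left and right endpoints, with height conditions in between. The
tableaux that follow the word and the matchings of its right endpoints with earlier left endpoints
(unmatched left endpoints belonging to open arcs, which end at `⊤`) satisfy the same recursion: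
a left endpoint `i` followed by a right endpoint `j` can be interchanged or cancelled.

For Ferrers diagrams this is the relation `UD = DU + 1` between the operators that add and remove
a box, refined by the length of the first column. For matchings, either `(i, j)` is not an arc,
and then a nesting misses the arc at `i` or the arc at `j`, as the two cross; or it is an arc, and
then it extends every nesting that passes over it by one. The recursion ends at words that begin
with a right endpoint, for which both sets are empty, and at words without right endpoints, for
which both have at most one element.
-/

namespace Hesitating

/-! ### Words and paths -/

/-- The letters of the words that record, from left to right, the endpoints of an arc diagram:
left endpoints named by `I`, right endpoints named by `J`, and checks, which bound from above the
statistic of a path, or the size of the nestings of a filling, at their position. -/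
inductive Token (I J : Type*)
  | left (i : I)
  | right (j : J)
  | check (c : ℤ)

section Words

variable {I J : Type*}

/-- The names of the left endpoints in a word, in order of appearance. -/
@[simp]
def lefts : List (Token I J) → List I
  | [] => []
  | .left i :: w => i :: lefts w
  | .right _ :: w => lefts w
  | .check _ :: w => lefts w

/-- The names of the right endpoints in a word, in order of appearance. -/
@[simp]
def rights : List (Token I J) → List J
  | [] => []
  | .left _ :: w => rights w
  | .right j :: w => j :: rights w
  | .check _ :: w => rights w

/-- The word that consists of the checks `cs`. -/
def checks (cs : List ℤ) : List (Token I J) := cs.map .check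

/-- An increase followed by a decrease, with the checks `cs` at the top. -/
def peak (i : I) (cs : List ℤ) (j : J) : List (Token I J) :=
  .left i :: (checks cs ++ [.right j])

/-- The word `peak i cs j` with `i` and `j` interchanged. The checks are repeated at both ends,
as the statistic at the top of a peak is the larger one of its values at the two ends. -/
def valley (i : I) (cs : List ℤ) (j : J) : List (Token I J) :=
  checks cs ++ .right j :: .left i :: checks cs

@[simp]
theorem lefts_append (u w : List (Token I J)) : lefts (u ++ w) = lefts u ++ lefts w := by
  induction u with
  | nil => rfl
  | cons t u ih => cases t <;> simp [ih]

@[simp]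
theorem rights_append (u w : List (Token I J)) : rights (u ++ w) = rights u ++ rights w := by
  induction u with
  | nil => rfl
  | cons t u ih => cases t <;> simp [ih]

@[simp]
theorem lefts_checks (cs : List ℤ) : lefts (checks cs : List (Token I J)) = [] := by
  induction cs with
  | nil => rfl
  | cons _ _ ih => exact ih

@[simp]
theorem rights_checks (cs : List ℤ) : rights (checks cs : List (Token I J)) = [] := by
  induction cs with
  | nil => rfl
  | cons _ _ ih => exact ih

@[simp]
theorem lefts_peak (i : I) (cs : List ℤ) (j : J) : lefts (peak i cs j) = [i] := by
  simp [peak]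

@[simp]
theorem rights_peak (i : I) (cs : List ℤ) (j : J) : rights (peak i cs j) = [j] := by
  simp [peak]

@[simp]
theorem lefts_valley (i : I) (cs : List ℤ) (j : J) : lefts (valley i cs j) = [i] := by
  simp [valley]

@[simp]
theorem rights_valley (i : I) (cs : List ℤ) (j : J) : rights (valley i cs j) = [j] := by
  simp [valley]

theorem exists_peak_or_right_or_rights_eq_nil (w : List (Token I J)) :
    (∃ u i cs j v, w = u ++ (peak i cs j ++ v)) ∨ (∃ cs j v, w = checks cs ++ .right j :: v) ∨
      rights w = [] := by
  induction w with
  | nil => exact .inr (.inr rfl)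
  | cons t w ih =>
    rcases ih with ⟨u, i, cs, j, v, rfl⟩ | ⟨cs, j, v, rfl⟩ | h
    · exact .inl ⟨t :: u, i, cs, j, v, rfl⟩
    · rcases t with i | j' | c
      · exact .inl ⟨[], i, cs, j, v, by simp [peak]⟩
      · exact .inr (.inl ⟨[], j', _, rfl⟩)
      · exact .inr (.inl ⟨c :: cs, j, v, rfl⟩)
    · rcases t with i | j | c
      · exact .inr (.inr h)
      · exact .inr (.inl ⟨[], j, w, rfl⟩)
      · exact .inr (.inr h)

/-- The number of pairs of a left endpoint and a later right endpoint. -/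
@[simp]
def inversions : List (Token I J) → ℕ
  | [] => 0
  | .left _ :: w => (rights w).length + inversions w
  | .right _ :: w => inversions w
  | .check _ :: w => inversions w

theorem inversions_append (u w : List (Token I J)) :
    inversions (u ++ w) = inversions u + (lefts u).length * (rights w).length + inversions w := by
  induction u with
  | nil => simp
  | cons t u ih => cases t <;> (simp [ih]; try ring)

theorem inversions_checks (cs : List ℤ) : inversions (checks cs : List (Token I J)) = 0 := by
  induction cs with
  | nil => rfl
  | cons _ _ ih => exact ih

theorem inversions_valley_lt (u : List (Token I J)) (i : I) (cs : List ℤ) (j : J)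
    (v : List (Token I J)) :
    inversions (u ++ (valley i cs j ++ v)) < inversions (u ++ (peak i cs j ++ v)) := by
  simp [inversions_append, inversions_checks, peak, valley]

theorem inversions_checks_lt (u : List (Token I J)) (i : I) (cs ds : List ℤ) (j : J)
    (v : List (Token I J)) :
    inversions (u ++ (checks ds ++ v)) < inversions (u ++ (peak i cs j ++ v)) := by
  simp only [inversions_append, inversions_checks, peak, inversions, lefts_append, lefts_checks,
    rights_append, rights_checks, lefts, rights, List.length_append, List.length_cons,
    List.length_nil]
  nlinarith

end Words

section Paths

universe u

variable {I J : Type*} {α : Type u}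

/-- The paths from `x` to `y` that follow a word: a left endpoint is an elementary increase, a
right endpoint is an elementary decrease, and a check bounds the statistic `s`. -/
def Path (up : α → α → Prop) (s : α → ℕ) : List (Token I J) → α → α → Type u
  | [], x, y => {_u : PUnit.{u + 1} // x = y}
  | .left _ :: w, x, y => Σ z : {z // up x z}, Path up s w z y
  | .right _ :: w, x, y => Σ z : {z // up z x}, Path up s w z y
  | .check c :: w, x, y => {_p : Path up s w x y // (s x : ℤ) ≤ c}

/-- The relation `UD = DU + 1` between the operators `U` and `D` of a differential poset, in a
form that keeps track of a statistic `s`, together with a chain `e 0, e 1, …` of elements whose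
only lower covers are their predecessors in the chain. -/
structure GrowthRule (up : α → α → Prop) (s : α → ℕ) (e : ℕ → α) : Prop where
  exists_equiv (x y : α) :
    ∃ ψ : {r // up r x ∧ up r y} ⊕ {_u : PUnit.{u + 1} // x = y} ≃ {z // up x z ∧ up y z},
      (∀ r, s (ψ (.inl r)) = max (s x) (s y)) ∧ ∀ h, s (ψ (.inr h)) = s x + 1
  up_iff (x : α) (m : ℕ) : up x (e m) ↔ ∃ p, m = p + 1 ∧ x = e p
  stat_eq (p : ℕ) : s (e p) = min p 1

namespace Path

variable {up : α → α → Prop} {s : α → ℕ}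

/-- Cut a path at the end of a prefix of its word. -/
def appendEquiv : ∀ (u v : List (Token I J)) (x y : α),
    Path up s (u ++ v) x y ≃ Σ z, Path up s u x z × Path up s v z y
  | [], _, x, _ =>
    ⟨fun p => ⟨x, ⟨⟨⟩, rfl⟩, p⟩, fun q => q.2.1.2 ▸ q.2.2, fun _ => rfl,
      fun ⟨_, ⟨_, h⟩, _⟩ => by subst h; rfl⟩
  | .left _ :: u, v, x, y =>
    show (Σ a : {a // up x a}, Path up s (u ++ v) a y) ≃
        Σ z, (Σ a : {a // up x a}, Path up s u a z) × Path up s v z y from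
      (Equiv.sigmaCongrRight fun a : {a // up x a} => appendEquiv u v a.1 y).trans
        ⟨fun ⟨a, z, p, q⟩ => ⟨z, ⟨a, p⟩, q⟩, fun ⟨z, ⟨a, p⟩, q⟩ => ⟨a, z, p, q⟩,
          fun _ => rfl, fun _ => rfl⟩
  | .right _ :: u, v, x, y =>
    show (Σ a : {a // up a x}, Path up s (u ++ v) a y) ≃
        Σ z, (Σ a : {a // up a x}, Path up s u a z) × Path up s v z y from
      (Equiv.sigmaCongrRight fun a : {a // up a x} => appendEquiv u v a.1 y).trans
        ⟨fun ⟨a, z, p, q⟩ => ⟨z, ⟨a, p⟩, q⟩, fun ⟨z, ⟨a, p⟩, q⟩ => ⟨a, z, p, q⟩,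
          fun _ => rfl, fun _ => rfl⟩
  | .check c :: u, v, x, y =>
    show {_p : Path up s (u ++ v) x y // (s x : ℤ) ≤ c} ≃
        Σ z, {_p : Path up s u x z // (s x : ℤ) ≤ c} × Path up s v z y from
      ((appendEquiv u v x y).subtypeEquiv (q := fun _ => (s x : ℤ) ≤ c) fun _ => Iff.rfl).trans
        ⟨fun ⟨⟨z, p, q⟩, h⟩ => ⟨z, ⟨p, h⟩, q⟩, fun ⟨z, ⟨p, h⟩, q⟩ => ⟨⟨z, p, q⟩, h⟩,
          fun _ => rfl, fun _ => rfl⟩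

/-- Collect the checks at the beginning of a path. -/
def checksAppendEquiv : ∀ (cs : List ℤ) (w : List (Token I J)) (x y : α),
    Path up s (checks cs ++ w) x y ≃ {_p : Path up s w x y // ∀ c ∈ cs, (s x : ℤ) ≤ c}
  | [], _, _, _ => (Equiv.subtypeUnivEquiv fun _ => by simp).symm
  | c :: cs, w, x, y =>
    show {_p : Path up s (checks cs ++ w) x y // (s x : ℤ) ≤ c} ≃ _ from
      ((checksAppendEquiv cs w x y).subtypeEquiv (q := fun _ => (s x : ℤ) ≤ c)
        fun _ => Iff.rfl).trans <|
        (Equiv.subtypeSubtypeEquivSubtypeInter _ fun _ => (s x : ℤ) ≤ c).trans <|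
          Equiv.subtypeEquivRight fun _ => by simp [and_comm]

/-- A path that consists of checks does not move. -/
def checksEquiv (cs : List ℤ) (x y : α) :
    Path up s (checks cs : List (Token I J)) x y ≃
      {_u : {_u : PUnit.{u + 1} // x = y} // ∀ c ∈ cs, (s x : ℤ) ≤ c} :=
  (Equiv.cast (by rw [List.append_nil])).trans (checksAppendEquiv (I := I) (J := J) cs [] x y)

/-- A peak is given by its top. -/
def peakEquiv (i : I) (cs : List ℤ) (j : J) (x y : α) :
    Path up s (peak i cs j) x y ≃
      {z : {z // up x z ∧ up y z} // ∀ c ∈ cs, (s z : ℤ) ≤ c} :=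
  show (Σ z : {z // up x z}, Path up s (checks cs ++ [.right j]) z y) ≃ _ from
    (Equiv.sigmaCongrRight fun z : {z // up x z} => checksAppendEquiv cs [.right j] z.1 y).trans
      ⟨fun ⟨z, ⟨r, _, h⟩, hz⟩ => ⟨⟨z, z.2, h ▸ r.2⟩, hz⟩,
        fun ⟨⟨z, hx, hy⟩, hz⟩ => ⟨⟨z, hx⟩, ⟨⟨y, hy⟩, ⟨⟩, rfl⟩, hz⟩,
        fun ⟨_, ⟨_, _, h⟩, _⟩ => by subst h; rfl, fun ⟨⟨_, _, _⟩, _⟩ => rfl⟩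

/-- A valley is given by its bottom. -/
def valleyEquiv (i : I) (cs : List ℤ) (j : J) (x y : α) :
    Path up s (valley i cs j) x y ≃
      {_r : {r // up r x ∧ up r y} // ∀ c ∈ cs, ((max (s x) (s y) : ℕ) : ℤ) ≤ c} :=
  have checksAtBoth : Path up s (valley i cs j) x y ≃
      {_p : Σ r : {r // up r x}, Σ z : {z // up r z},
        {_u : {_u : PUnit.{u + 1} // z.1 = y} // ∀ c ∈ cs, (s z : ℤ) ≤ c} //
        ∀ c ∈ cs, (s x : ℤ) ≤ c} :=
    (checksAppendEquiv cs _ x y).trans <| Equiv.subtypeEquiv (Equiv.sigmaCongrRight fun _ =>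
      Equiv.sigmaCongrRight fun z => checksEquiv cs z.1 y) fun _ => Iff.rfl
  checksAtBoth.trans
    ⟨fun ⟨⟨r, z, ⟨_, h⟩, hz⟩, hx⟩ => ⟨⟨r, r.2, h ▸ z.2⟩, fun c hc => by
        subst h; exact Nat.cast_max (α := ℤ) .. ▸ max_le (hx c hc) (hz c hc)⟩,
      fun ⟨⟨r, hx, hy⟩, hr⟩ =>
        ⟨⟨⟨r, hx⟩, ⟨y, hy⟩, ⟨⟨⟩, rfl⟩, fun c hc => le_trans (by simp) (hr c hc)⟩,
          fun c hc => le_trans (by simp) (hr c hc)⟩,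
      fun ⟨⟨_, _, ⟨_, h⟩, _⟩, _⟩ => by subst h; rfl, fun ⟨⟨_, _, _⟩, _⟩ => rfl⟩

/-- A decomposition of the paths that follow a word persists in every context. -/
def contextEquivSum {a b c : List (Token I J)}
    (ψ : ∀ x y, Path up s a x y ≃ Path up s b x y ⊕ Path up s c x y)
    (u v : List (Token I J)) (x y : α) :
    Path up s (u ++ (a ++ v)) x y ≃
      Path up s (u ++ (b ++ v)) x y ⊕ Path up s (u ++ (c ++ v)) x y :=
  have split (a : List (Token I J)) : Path up s (u ++ (a ++ v)) x y ≃
      Σ z, Path up s u x z × Σ z', Path up s a z z' × Path up s v z' y :=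
    (appendEquiv u (a ++ v) x y).trans <|
      Equiv.sigmaCongrRight fun z => .prodCongrRight fun _ => appendEquiv a v z y
  have distrib (z : α) : (Σ z', Path up s a z z' × Path up s v z' y) ≃
      (Σ z', Path up s b z z' × Path up s v z' y) ⊕ Σ z', Path up s c z z' × Path up s v z' y :=
    (Equiv.sigmaCongrRight fun z' =>
      (Equiv.prodCongrLeft fun _ => ψ z z').trans (Equiv.sumProdDistrib _ _ _)).trans <|
        Equiv.sigmaSumDistrib _ _
  (split a).trans <| (Equiv.sigmaCongrRight fun z =>
    (Equiv.prodCongrRight fun _ => distrib z).trans (Equiv.prodSumDistrib _ _ _)).trans <|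
      (Equiv.sigmaSumDistrib _ _).trans (.sumCongr (split b).symm (split c).symm)

end Path

/-- The checks of a word without right endpoints hold along the chain of a growth rule, when `p`
is the number of the element of the chain at the start of the word. -/
@[simp]
def OpenChecks : ℕ → List (Token I J) → Prop
  | _, [] => True
  | p, .left _ :: w => OpenChecks (p + 1) w
  | p, .right _ :: w => OpenChecks p w
  | p, .check c :: w => ((min p 1 : ℕ) : ℤ) ≤ c ∧ OpenChecks p w

namespace GrowthRule

variable {up : α → α → Prop} {s : α → ℕ} {e : ℕ → α}

theorem nonempty_path_peak_equiv (h : GrowthRule up s e) (i : I) (cs : List ℤ) (j : J) (x y : α) :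
    Nonempty (Path up s (peak i cs j) x y ≃
      Path up s (valley i cs j) x y ⊕
        Path up s (checks (cs.map (· - 1)) : List (Token I J)) x y) := by
  obtain ⟨ψ, hinl, hinr⟩ := h.exists_equiv x y
  refine ⟨(Path.peakEquiv i cs j x y).trans <|
    (ψ.symm.subtypeEquiv (q := fun a => ∀ c ∈ cs, (s (ψ a) : ℤ) ≤ c) fun _ => by simp).trans <|
    Equiv.subtypeSum.trans <| .sumCongr
      (.trans (Equiv.subtypeEquivRight fun r => ?_) (Path.valleyEquiv i cs j x y).symm)
      (.trans (Equiv.subtypeEquivRight fun r => ?_) (Path.checksEquiv _ x y).symm)⟩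
  · rw [hinl]
  · simp [hinr, le_sub_iff_add_le]

theorem nonempty_path_context_equiv (h : GrowthRule up s e) (u : List (Token I J)) (i : I)
    (cs : List ℤ) (j : J) (v : List (Token I J)) (x y : α) :
    Nonempty (Path up s (u ++ (peak i cs j ++ v)) x y ≃
      Path up s (u ++ (valley i cs j ++ v)) x y ⊕
        Path up s (u ++ (checks (cs.map (· - 1)) ++ v)) x y) :=
  ⟨Path.contextEquivSum (fun x y => (h.nonempty_path_peak_equiv i cs j x y).some) u v x y⟩

theorem isEmpty_path_right (h : GrowthRule up s e) (cs : List ℤ) (j : J) (v : List (Token I J))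
    (y : α) : IsEmpty (Path up s (checks cs ++ .right j :: v) (e 0) y) := by
  refine ⟨fun p => ?_⟩
  obtain ⟨⟨⟨z, hz⟩, -⟩, -⟩ := Path.checksAppendEquiv cs _ _ _ p
  obtain ⟨p, hp, -⟩ := (h.up_iff z 0).1 hz
  omega

theorem nonempty_path_iff (h : GrowthRule up s e) {w : List (Token I J)} (hw : rights w = [])
    {x : α} {m : ℕ} : Nonempty (Path up s w x (e m)) ↔
      ∃ p, x = e p ∧ p + (lefts w).length = m ∧ OpenChecks p w := by
  induction w generalizing x with
  | nil => simp [Path]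
  | cons t w ih =>
    rcases t with i | j | c
    · simp only [Path, nonempty_sigma, ih hw, Subtype.exists, exists_prop, OpenChecks, lefts,
        List.length_cons]
      constructor
      · rintro ⟨_, hz, p, rfl, hp, hw⟩
        obtain ⟨q, rfl, rfl⟩ := (h.up_iff _ _).1 hz
        exact ⟨q, rfl, by omega, hw⟩
      · rintro ⟨q, rfl, hq, hw⟩
        exact ⟨_, (h.up_iff _ _).2 ⟨q, rfl, rfl⟩, q + 1, rfl, by omega, hw⟩
    · cases hw
    · simp only [Path, nonempty_subtype, exists_const_iff, ih hw, OpenChecks,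
        lefts]
      constructor
      · rintro ⟨⟨p, rfl, hp, hw⟩, hc⟩
        exact ⟨p, rfl, hp, h.stat_eq p ▸ hc, hw⟩
      · rintro ⟨p, rfl, hp, hc, hw⟩
        exact ⟨⟨p, rfl, hp, hw⟩, (h.stat_eq p).symm ▸ hc⟩

theorem subsingleton_path (h : GrowthRule up s e) {w : List (Token I J)} (hw : rights w = [])
    (x : α) (m : ℕ) : Subsingleton (Path up s w x (e m)) := by
  induction w generalizing x with
  | nil => exact inferInstanceAs (Subsingleton {_u : PUnit // x = e m})
  | cons t w ih =>
    rcases t with i | j | c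
    · refine ⟨fun ⟨⟨z, hz⟩, p⟩ ⟨⟨z', hz'⟩, p'⟩ => ?_⟩
      obtain ⟨q, rfl, hq, -⟩ := (h.nonempty_path_iff (w := w) hw).1 ⟨p⟩
      obtain ⟨q', rfl, hq', -⟩ := (h.nonempty_path_iff (w := w) hw).1 ⟨p'⟩
      obtain rfl : q = q' := by omega
      have := ih hw (e q)
      exact congrArg (Sigma.mk _) (Subsingleton.elim p p')
    · cases hw
    · have := ih hw x
      exact inferInstanceAs (Subsingleton {_p : Path up s w x (e m) // (s x : ℤ) ≤ c})

end GrowthRule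

end Paths

/-! ### Nestings and fillings -/

section NestingBound

variable {I J : Type*} [Preorder I] [Preorder J]

/-- The arc `p` covers the arc `q`. -/
def Nests (p q : I × J) : Prop := p.1 < q.1 ∧ q.2 < p.2

/-- All nestings of arcs of `F` have at most `c` arcs. -/
def NestingBound (F : Set (I × J)) (c : ℤ) : Prop :=
  ∀ S : Finset (I × J), ↑S ⊆ F → IsChain Nests (S : Set (I × J)) → (S.card : ℤ) ≤ c

variable {F G : Set (I × J)} {c : ℤ}

theorem NestingBound.mono (h : NestingBound F c) (hGF : G ⊆ F) : NestingBound G c :=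
  fun S hS => h S (hS.trans hGF)

theorem nestingBound_union
    (h : ∀ p ∈ F \ G, ∀ q ∈ G \ F, ¬ Nests p q ∧ ¬ Nests q p) :
    NestingBound (F ∪ G) c ↔ NestingBound F c ∧ NestingBound G c := by
  refine ⟨fun hFG => ⟨hFG.mono Set.subset_union_left, hFG.mono Set.subset_union_right⟩,
    fun ⟨hF, hG⟩ S hS hchain => ?_⟩
  by_cases hSF : ↑S ⊆ F
  · exact hF S hSF hchain
  · obtain ⟨q, hq, hqF⟩ := Set.not_subset.1 hSF
    have hqG := (hS hq).resolve_left hqF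
    refine hG S (fun p hp => ?_) hchain
    by_contra hpG
    have hpF := (hS hp).resolve_right hpG
    exact (hchain hp hq fun hpq => hqF (hpq ▸ hpF)).elim
      (h p ⟨hpF, hpG⟩ q ⟨hqG, hqF⟩).1 (h p ⟨hpF, hpG⟩ q ⟨hqG, hqF⟩).2

theorem nestingBound_insert {p : I × J} (h : ∀ q ∈ F, Nests q p) :
    NestingBound (insert p F) c ↔ NestingBound F (c - 1) := by
  classical
  have hp : p ∉ F := fun hp => lt_irrefl _ (h p hp).1
  constructor
  · intro hF S hS hchain
    have := hF (insert p S) (by simpa using Set.insert_subset_insert hS)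
      (by simpa using hchain.insert fun q hq _ => .inr (h q (hS hq)))
    rw [Finset.card_insert_of_notMem fun hpS => hp (hS hpS)] at this
    push_cast at this
    linarith
  · intro hF S hS hchain
    have := hF (S.erase p) (by simpa [Set.subset_def, or_iff_not_imp_left] using hS)
      (hchain.mono (by simp))
    have := Finset.pred_card_le_card_erase (s := S) (a := p)
    omega

end NestingBound

section Valid

variable {I J : Type*} [Preorder I] [Preorder J]

/-- When `F` is read as a set of arcs, each right endpoint of the word `w` is matched by `F` to an
earlier left endpoint, and each check `c` of `w` bounds the nestings of the arcs that pass over it.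
Here `A` and `B` are the left endpoints before `w` and the right endpoints after `w`. -/
def Valid (F : Set (I × J)) : List I → List J → List (Token I J) → Prop
  | _, _, [] => True
  | A, B, .left i :: w => Valid F (A ++ [i]) B w
  | A, B, .right j :: w => (∃ a ∈ A, (a, j) ∈ F) ∧ Valid F A B w
  | A, B, .check c :: w =>
    NestingBound {p ∈ F | p.1 ∈ A ∧ p.2 ∈ rights w ++ B} c ∧ Valid F A B w

variable {F : Set (I × J)} {A : List I} {B : List J}

theorem valid_append {u w : List (Token I J)} :
    Valid F A B (u ++ w) ↔ Valid F A (rights w ++ B) u ∧ Valid F (A ++ lefts u) B w := by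
  induction u generalizing A with
  | nil => simp [Valid]
  | cons t u ih => cases t <;> simp [Valid, ih, and_assoc]

theorem valid_checks {cs : List ℤ} :
    Valid F A B (checks cs) ↔ ∀ c ∈ cs, NestingBound {p ∈ F | p.1 ∈ A ∧ p.2 ∈ B} c := by
  induction cs with
  | nil => simp [Valid, checks]
  | cons c cs ih =>
    rw [List.forall_mem_cons, ← ih]
    simp only [checks, List.map_cons, Valid]
    rw [show rights (cs.map Token.check : List (Token I J)) = [] from rights_checks cs,
      List.nil_append]

theorem valid_peak {i : I} {cs : List ℤ} {j : J} :
    Valid F A B (peak i cs j) ↔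
      (∀ c ∈ cs, NestingBound {p ∈ F | p.1 ∈ A ++ [i] ∧ p.2 ∈ j :: B} c) ∧
        ∃ a ∈ A ++ [i], (a, j) ∈ F := by
  simp only [peak, Valid, valid_append, valid_checks, rights, lefts_checks, List.append_nil,
    List.cons_append, List.nil_append, and_true]

theorem valid_valley {i : I} {cs : List ℤ} {j : J} :
    Valid F A B (valley i cs j) ↔
      (∀ c ∈ cs, NestingBound {p ∈ F | p.1 ∈ A ∧ p.2 ∈ j :: B} c) ∧
        (∃ a ∈ A, (a, j) ∈ F) ∧
          ∀ c ∈ cs, NestingBound {p ∈ F | p.1 ∈ A ++ [i] ∧ p.2 ∈ B} c := by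
  simp only [valley, Valid, valid_append, valid_checks, rights, rights_checks, lefts_checks,
    List.append_nil, List.cons_append, List.nil_append]

theorem valid_congr {F' : Set (I × J)} {A' : List I} {B' : List J} {w : List (Token I J)}
    (h : ∀ C ⊆ lefts w, ∀ D ⊆ rights w, ∀ p,
      p ∈ F ∧ p.1 ∈ A ++ C ∧ p.2 ∈ D ++ B ↔ p ∈ F' ∧ p.1 ∈ A' ++ C ∧ p.2 ∈ D ++ B') :
    Valid F A B w ↔ Valid F' A' B' w := by
  induction w generalizing A A' with
  | nil => rfl
  | cons t w ih =>
    rcases t with i | j | c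
    · exact ih fun C hC D hD p => by simpa using h (i :: C) (List.cons_subset_cons i hC) D hD p
    · refine and_congr (exists_congr fun a => ?_)
        (ih fun C hC D hD => h C hC D (List.subset_cons_of_subset j hD))
      rw [and_comm, and_comm (a := a ∈ A')]
      simpa using h [] (by simp) [j] (by simp) (a, j)
    · refine and_congr (iff_of_eq (congrArg (NestingBound · c) (Set.ext fun p => ?_))) (ih h)
      simpa only [List.append_nil, Set.mem_ofPred_eq] using
        h [] (by simp) (rights w) (List.Subset.refl _) p

/-- An arc that ends at `i` and an arc that ends at `j` cross, so a nesting misses one of them. -/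
theorem valid_peak_iff_valid_valley {i : I} {cs : List ℤ} {j : J} (hi : ∀ a ∈ A, a < i)
    (hj : ∀ b ∈ B, j < b) (hij : (i, j) ∉ F) :
    Valid F A B (peak i cs j) ↔ Valid F A B (valley i cs j) := by
  have hunion : {p ∈ F | p.1 ∈ A ++ [i] ∧ p.2 ∈ j :: B} =
      {p ∈ F | p.1 ∈ A ∧ p.2 ∈ j :: B} ∪ {p ∈ F | p.1 ∈ A ++ [i] ∧ p.2 ∈ B} := by
    ext ⟨a, b⟩
    simp only [Set.mem_ofPred_eq, Set.mem_union, List.mem_append, List.mem_cons,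
      List.not_mem_nil, or_false]
    grind
  have hbound (c : ℤ) := hunion ▸ nestingBound_union (F := {p ∈ F | p.1 ∈ A ∧ p.2 ∈ j :: B})
    (G := {p ∈ F | p.1 ∈ A ++ [i] ∧ p.2 ∈ B}) (c := c) (by
      rintro ⟨a, b⟩ ⟨⟨haF, ha, hb⟩, hab⟩ ⟨a', b'⟩ ⟨⟨haF', ha', hb'⟩, hab'⟩
      simp only [Nests, Set.mem_ofPred_eq, List.mem_append, List.mem_cons, List.not_mem_nil,
        or_false] at *
      grind)
  have hexists : (∃ a ∈ A ++ [i], (a, j) ∈ F) ↔ ∃ a ∈ A, (a, j) ∈ F := by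
    simp [or_and_right, exists_or, hij]
  simp only [valid_peak, valid_valley, hbound, forall_and, hexists, and_assoc]
  tauto

/-- The arc `(i, j)` extends every nesting that passes over it. -/
theorem valid_insert_peak_iff {i : I} {cs : List ℤ} {j : J} (hi : ∀ a ∈ A, a < i)
    (hj : ∀ b ∈ B, j < b) (hFi : ∀ b, (i, b) ∉ F) (hFj : ∀ a, (a, j) ∉ F) :
    Valid (insert (i, j) F) A B (peak i cs j) ↔ Valid F A B (checks (cs.map (· - 1))) := by
  have hinsert : {p ∈ insert (i, j) F | p.1 ∈ A ++ [i] ∧ p.2 ∈ j :: B} =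
      insert (i, j) {p ∈ F | p.1 ∈ A ∧ p.2 ∈ B} := by
    ext ⟨a, b⟩
    simp only [Set.mem_ofPred_eq, Set.mem_insert_iff, List.mem_append, List.mem_cons,
      List.not_mem_nil, or_false, Prod.mk.injEq]
    grind
  have hbound (c : ℤ) := hinsert ▸ nestingBound_insert (F := {p ∈ F | p.1 ∈ A ∧ p.2 ∈ B}) (c := c)
    (p := (i, j)) fun q hq => ⟨hi _ hq.2.1, hj _ hq.2.2⟩
  simp only [valid_peak, valid_checks, hbound, List.forall_mem_map]
  exact and_iff_left ⟨i, by simp, .inl rfl⟩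

end Valid

section Filling

variable {I J : Type*} [LinearOrder I] [LinearOrder J] [OrderTop J]

/-- The left endpoints and the right endpoints of a word appear in increasing order. -/
def IsSorted (w : List (Token I J)) : Prop :=
  (lefts w).Pairwise (· < ·) ∧ (rights w ++ [⊤]).Pairwise (· < ·)

/-- The set `F` matches each right endpoint of the word `w` to an earlier left endpoint, and the
other `m` left endpoints, which are those of open arcs, to `⊤`, in accordance with all checks. -/
structure Filling (w : List (Token I J)) (m : ℕ) (F : Set (I × J)) : Prop where
  mem_lefts : ∀ p ∈ F, p.1 ∈ lefts w
  mem_rights : ∀ p ∈ F, p.2 ∈ rights w ++ [⊤]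
  exists_right : ∀ i ∈ lefts w, ∃ b, (i, b) ∈ F
  left_unique : ∀ i b b', (i, b) ∈ F → (i, b') ∈ F → b = b'
  right_unique : ∀ i i' b, b ≠ ⊤ → (i, b) ∈ F → (i', b) ∈ F → i = i'
  ncard_top : {i | (i, ⊤) ∈ F}.ncard = m
  valid : Valid F [] [⊤] w

variable {u v : List (Token I J)} {i : I} {j : J} {cs : List ℤ} {m : ℕ} {F : Set (I × J)}

theorem isSorted_peak_iff : IsSorted (u ++ (peak i cs j ++ v)) ↔
    IsSorted (u ++ (checks (cs.map (· - 1)) ++ v)) ∧ (∀ a ∈ lefts u, a < i) ∧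
      (∀ a ∈ lefts v, i < a) ∧ (∀ b ∈ rights u, b < j) ∧ ∀ b ∈ rights v ++ [⊤], j < b := by
  simp only [IsSorted, lefts_append, rights_append, lefts_peak, rights_peak, lefts_checks,
    rights_checks, List.append_assoc, List.cons_append, List.nil_append, List.pairwise_append,
    List.pairwise_cons, List.mem_cons, List.mem_append]
  grind

theorem valid_peak_context_iff (h : IsSorted (u ++ (peak i cs j ++ v))) (hij : (i, j) ∉ F) :
    Valid F [] [⊤] (u ++ (peak i cs j ++ v)) ↔ Valid F [] [⊤] (u ++ (valley i cs j ++ v)) := by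
  obtain ⟨-, hu, -, -, hv⟩ := isSorted_peak_iff.1 h
  simp only [valid_append, rights_append, rights_peak, rights_valley, lefts_peak, lefts_valley,
    List.nil_append, valid_peak_iff_valid_valley hu hv hij]

theorem valid_insert_peak_context_iff (h : IsSorted (u ++ (peak i cs j ++ v)))
    (hFi : ∀ b, (i, b) ∉ F) (hFj : ∀ a, (a, j) ∉ F) :
    Valid (insert (i, j) F) [] [⊤] (u ++ (peak i cs j ++ v)) ↔
      Valid F [] [⊤] (u ++ (checks (cs.map (· - 1)) ++ v)) := by
  obtain ⟨-, hiu, -, -, hjv⟩ := isSorted_peak_iff.1 h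
  simp only [valid_append, rights_append, rights_peak, rights_checks, lefts_peak, lefts_checks,
    List.nil_append, List.append_nil, valid_insert_peak_iff hiu hjv hFi hFj]
  refine and_congr (valid_congr ?_) (and_congr_right fun _ => valid_congr ?_)
  · rintro C hC D - ⟨a, b⟩
    have : i ∉ C := fun hi => lt_irrefl _ (hiu i (hC hi))
    simp only [Set.mem_insert_iff, Prod.mk.injEq, List.nil_append, List.mem_append, List.mem_cons]
    grind
  · rintro C - D hD ⟨a, b⟩
    have : j ∉ D ++ [⊤] := fun hj => lt_irrefl _ (hjv j (by
      simp only [List.mem_append] at hj ⊢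
      exact hj.imp_left fun hj => hD hj))
    simp only [Set.mem_insert_iff, Prod.mk.injEq, List.mem_append, List.mem_cons] at this ⊢
    grind

theorem filling_peak_and_notMem_iff (h : IsSorted (u ++ (peak i cs j ++ v))) :
    Filling (u ++ (peak i cs j ++ v)) m F ∧ (i, j) ∉ F ↔
      Filling (u ++ (valley i cs j ++ v)) m F := by
  have hlefts : lefts (u ++ (peak i cs j ++ v)) = lefts (u ++ (valley i cs j ++ v)) := by simp
  have hrights : rights (u ++ (peak i cs j ++ v)) = rights (u ++ (valley i cs j ++ v)) := by simp
  constructor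
  · rintro ⟨⟨h₁, h₂, h₃, h₄, h₅, h₆, hvalid⟩, hij⟩
    exact ⟨hlefts ▸ h₁, hrights ▸ h₂, hlefts ▸ h₃, h₄, h₅, h₆,
      (valid_peak_context_iff h hij).1 hvalid⟩
  · rintro ⟨h₁, h₂, h₃, h₄, h₅, h₆, hvalid⟩
    have hij : (i, j) ∉ F := by
      intro hij
      obtain ⟨-, hu, -, -, hv⟩ := isSorted_peak_iff.1 h
      simp only [valid_append, valid_valley] at hvalid
      obtain ⟨-, ⟨-, ⟨a, ha, haj⟩, -⟩, -⟩ := hvalid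
      exact (hu a ha).ne (h₅ a i j (hv ⊤ (by simp)).ne haj hij)
    exact ⟨⟨hlefts ▸ h₁, hrights ▸ h₂, hlefts ▸ h₃, h₄, h₅, h₆,
      (valid_peak_context_iff h hij).2 hvalid⟩, hij⟩

theorem notMem_of_filling_checks (h : IsSorted (u ++ (peak i cs j ++ v)))
    (hF : Filling (u ++ (checks (cs.map (· - 1)) ++ v)) m F) :
    (∀ b, (i, b) ∉ F) ∧ ∀ a, (a, j) ∉ F := by
  obtain ⟨-, hiu, hiv, hju, hjv⟩ := isSorted_peak_iff.1 h
  constructor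
  · intro b hb
    have := hF.mem_lefts _ hb
    simp only [lefts_append, lefts_checks, List.mem_append] at this
    grind
  · intro a ha
    have := hF.mem_rights _ ha
    simp only [rights_append, rights_checks, List.mem_append] at this hjv
    grind

theorem filling_insert_peak_iff (h : IsSorted (u ++ (peak i cs j ++ v))) (hij : (i, j) ∉ F) :
    Filling (u ++ (peak i cs j ++ v)) m (insert (i, j) F) ↔
      Filling (u ++ (checks (cs.map (· - 1)) ++ v)) m F := by
  obtain ⟨-, hiu, hiv, hju, hjv⟩ := isSorted_peak_iff.1 h
  have hj : j ≠ ⊤ := (hjv ⊤ (by simp)).ne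
  have htop : {a | (a, ⊤) ∈ insert (i, j) F} = {a | (a, ⊤) ∈ F} := by
    ext a
    simp [hj.symm]
  constructor
  · rintro ⟨h₁, h₂, h₃, h₄, h₅, h₆, h₇⟩
    have hFi (b : J) (hb : (i, b) ∈ F) : False := hij (h₄ i b j (.inr hb) (.inl rfl) ▸ hb)
    have hFj (a : I) (ha : (a, j) ∈ F) : False := hij (h₅ a i j hj (.inr ha) (.inl rfl) ▸ ha)
    refine ⟨?_, ?_, ?_, fun i b b' hb hb' => h₄ i b b' (.inr hb) (.inr hb'),
      fun i i' b hb hi hi' => h₅ i i' b hb (.inr hi) (.inr hi'), htop ▸ h₆,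
      (valid_insert_peak_context_iff h hFi hFj).1 h₇⟩
    all_goals
      simp only [lefts_append, rights_append, lefts_peak, rights_peak, lefts_checks, rights_checks,
        List.mem_append, List.mem_cons, Set.mem_insert_iff, Prod.mk.injEq, Prod.forall] at *
      grind
  · intro hF
    obtain ⟨hFi, hFj⟩ := notMem_of_filling_checks h hF
    obtain ⟨h₁, h₂, h₃, h₄, h₅, h₆, h₇⟩ := hF
    refine ⟨?_, ?_, ?_, ?_, ?_, htop ▸ h₆, (valid_insert_peak_context_iff h hFi hFj).2 h₇⟩
    all_goals
      simp only [lefts_append, rights_append, lefts_peak, rights_peak, lefts_checks, rights_checks,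
        List.mem_append, List.mem_cons, Set.mem_insert_iff, Prod.mk.injEq, Prod.forall] at *
      grind

theorem nonempty_filling_peak_equiv (h : IsSorted (u ++ (peak i cs j ++ v))) (m : ℕ) :
    Nonempty ({F // Filling (u ++ (peak i cs j ++ v)) m F} ≃
      {F // Filling (u ++ (valley i cs j ++ v)) m F} ⊕
        {F // Filling (u ++ (checks (cs.map (· - 1)) ++ v)) m F}) := by
  classical
  have notMem {F : Set (I × J)} (hF : Filling (u ++ (checks (cs.map (· - 1)) ++ v)) m F) :
      (i, j) ∉ F := (notMem_of_filling_checks h hF).1 j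
  refine ⟨(Equiv.sumCompl fun F : {F // Filling (u ++ (peak i cs j ++ v)) m F} =>
    (i, j) ∉ F.1).symm.trans (.sumCongr ?_ ?_)⟩
  · exact (Equiv.subtypeSubtypeEquivSubtypeInter _ _).trans
      (.subtypeEquivRight fun F => filling_peak_and_notMem_iff h)
  · exact
      { toFun F := ⟨F.1.1 \ {(i, j)}, (filling_insert_peak_iff h (by simp)).1 (by
            rw [Set.insert_sdiff_singleton, Set.insert_eq_of_mem (not_not.1 F.2)]
            exact F.1.2)⟩
        invFun F := ⟨⟨insert (i, j) F.1, (filling_insert_peak_iff h (notMem F.2)).2 F.2⟩,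
          not_not.2 (Set.mem_insert _ _)⟩
        left_inv F := Subtype.ext <| Subtype.ext <|
          Set.insert_sdiff_singleton.trans (Set.insert_eq_of_mem (not_not.1 F.2))
        right_inv F := Subtype.ext <| Set.insert_sdiff_self_of_notMem (notMem F.2) }

theorem isEmpty_filling_right (cs : List ℤ) (j : J) (v : List (Token I J)) (m : ℕ) :
    IsEmpty {F : Set (I × J) // Filling (checks cs ++ .right j :: v) m F} := by
  refine ⟨fun F => ?_⟩
  have h := F.2.valid
  simp [valid_append, Valid] at h

theorem nestingBound_openArcs_iff {A : List I} {c : ℤ} (hF : ∀ a ∈ A, (a, ⊤) ∈ F) :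
    NestingBound {p ∈ F | p.1 ∈ A ∧ p.2 ∈ [⊤]} c ↔ ((min A.length 1 : ℕ) : ℤ) ≤ c := by
  constructor
  · intro h
    rcases A with _ | ⟨a, A⟩
    · simpa using h ∅ (by simp) (by simp)
    · have hsub : ↑({(a, ⊤)} : Finset (I × J)) ⊆ {p ∈ F | p.1 ∈ a :: A ∧ p.2 ∈ [⊤]} := by
        rw [Finset.coe_singleton, Set.singleton_subset_iff]
        exact ⟨hF a (by simp), by simp, by simp⟩
      simpa using h _ hsub (by simp)
  · intro h S hS hchain
    have hcard : S.card ≤ 1 := by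
      refine Finset.card_le_one.2 fun q hq r hr => by_contra fun hqr => ?_
      have hq := List.mem_singleton.1 (hS hq).2.2
      have hr := List.mem_singleton.1 (hS hr).2.2
      rcases hchain ‹_› ‹_› hqr with h | h <;> simp [Nests, hq, hr] at h
    have hA : S.card ≤ A.length := by
      rcases S.eq_empty_or_nonempty with rfl | ⟨q, hq⟩
      · simp
      · exact hcard.trans (List.length_pos_of_mem (hS hq).2.1)
    exact le_trans (by exact_mod_cast le_min hA hcard) h

theorem valid_iff_openChecks {w : List (Token I J)} (hw : rights w = []) {A : List I}
    (hF : ∀ a ∈ A ++ lefts w, (a, ⊤) ∈ F) : Valid F A [⊤] w ↔ OpenChecks A.length w := by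
  induction w generalizing A with
  | nil => rfl
  | cons t w ih =>
    rcases t with i | j | c
    · simpa [Valid] using ih hw (A := A ++ [i]) (by simpa using hF)
    · cases hw
    · refine and_congr ?_ (ih hw hF)
      rw [show rights w = [] from hw]
      exact nestingBound_openArcs_iff fun a ha => hF a (List.mem_append_left _ ha)

theorem filling_iff_of_rights_eq_nil {w : List (Token I J)} (hsorted : IsSorted w)
    (hw : rights w = []) : Filling w m F ↔
      F = {i | i ∈ lefts w} ×ˢ {⊤} ∧ (lefts w).length = m ∧ OpenChecks 0 w := by
  classical
  have hncard : {i | (i, ⊤) ∈ {i | i ∈ lefts w} ×ˢ {(⊤ : J)}}.ncard = (lefts w).length := by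
    have hnodup : (lefts w).Nodup := hsorted.1.imp ne_of_lt
    rw [← List.toFinset_card_of_nodup hnodup, ← Set.ncard_coe_finset]
    exact congrArg _ (Set.ext fun i => by simp)
  constructor
  · intro hF
    have htop (i : I) (b : J) (hb : (i, b) ∈ F) : b = ⊤ := by
      simpa [hw] using hF.mem_rights _ hb
    obtain rfl : F = {i | i ∈ lefts w} ×ˢ {⊤} := by
      ext ⟨i, b⟩
      refine ⟨fun hb => ⟨hF.mem_lefts _ hb, htop i b hb⟩, ?_⟩
      rintro ⟨hi, rfl : b = ⊤⟩
      obtain ⟨b, hb⟩ := hF.exists_right i hi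
      exact htop i b hb ▸ hb
    exact ⟨rfl, hncard.symm.trans hF.ncard_top, (valid_iff_openChecks hw (by simp)).1 hF.valid⟩
  · rintro ⟨rfl, hm, hchecks⟩
    exact
      { mem_lefts := fun p hp => hp.1
        mem_rights := fun p hp => by simpa [hw] using hp.2
        exists_right := fun i hi => ⟨⊤, hi, rfl⟩
        left_unique := fun i b b' hb hb' => hb.2.trans hb'.2.symm
        right_unique := fun i i' b hb hi => absurd hi.2 hb
        ncard_top := hncard.trans hm
        valid := (valid_iff_openChecks hw (by simp)).2 hchecks }

end Filling

section Equiv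

universe u

variable {I J : Type*} [LinearOrder I] [LinearOrder J] [OrderTop J] {α : Type u}
  {up : α → α → Prop} {s : α → ℕ} {e : ℕ → α} {w : List (Token I J)}

theorem nonempty_path_equiv_filling_of_rights_eq_nil (h : GrowthRule up s e) (m : ℕ)
    (hsorted : IsSorted w) (hw : rights w = []) :
    Nonempty (Path up s w (e 0) (e m) ≃ {F // Filling w m F}) := by
  have := h.subsingleton_path hw (e 0) m
  have : Subsingleton {F // Filling w m F} := ⟨fun F F' => Subtype.ext <|
    ((filling_iff_of_rights_eq_nil hsorted hw).1 F.2).1.trans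
      ((filling_iff_of_rights_eq_nil hsorted hw).1 F'.2).1.symm⟩
  have hiff : Nonempty (Path up s w (e 0) (e m)) ↔ Nonempty {F // Filling w m F} := by
    simp only [h.nonempty_path_iff hw, nonempty_subtype, filling_iff_of_rights_eq_nil hsorted hw,
      exists_eq_left]
    constructor
    · rintro ⟨p, hp, hm, hchecks⟩
      obtain rfl : p = 0 := by
        have := h.stat_eq p
        rw [← hp, h.stat_eq] at this
        omega
      exact ⟨by omega, hchecks⟩
    · rintro ⟨hm, hchecks⟩
      exact ⟨0, rfl, by omega, hchecks⟩
  exact ⟨equivOfSubsingletonOfSubsingleton (fun p => (hiff.1 ⟨p⟩).some)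
    fun F => (hiff.2 ⟨F⟩).some⟩

theorem nonempty_path_equiv_filling (h : GrowthRule up s e) (m : ℕ) (hw : IsSorted w) :
    Nonempty (Path up s w (e 0) (e m) ≃ {F // Filling w m F}) := by
  induction hN : inversions w using Nat.strong_induction_on generalizing w with
  | _ N ih =>
    subst hN
    rcases exists_peak_or_right_or_rights_eq_nil w with
      ⟨u, i, cs, j, v, rfl⟩ | ⟨cs, j, v, rfl⟩ | hrights
    · have hvalley : IsSorted (u ++ (valley i cs j ++ v)) := by simpa [IsSorted] using hw
      obtain ⟨pathEquiv⟩ := h.nonempty_path_context_equiv u i cs j v (e 0) (e m)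
      obtain ⟨valleyEquiv⟩ := ih _ (inversions_valley_lt u i cs j v) hvalley rfl
      obtain ⟨checksEquiv⟩ :=
        ih _ (inversions_checks_lt u i cs (cs.map (· - 1)) j v) (isSorted_peak_iff.1 hw).1 rfl
      obtain ⟨fillingEquiv⟩ := nonempty_filling_peak_equiv hw m
      exact ⟨pathEquiv.trans ((valleyEquiv.sumCongr checksEquiv).trans fillingEquiv.symm)⟩
    · have := h.isEmpty_path_right cs j v (e m)
      have := isEmpty_filling_right (I := I) cs j v m
      exact ⟨Equiv.equivOfIsEmpty _ _⟩
    · exact nonempty_path_equiv_filling_of_rights_eq_nil h m hw hrights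

end Equiv

/-! ### The growth rule of Ferrers diagrams -/

theorem exists_equiv_of_biUnique {α β : Type*} {R : α → β → Prop} (hR : Relator.BiUnique R) :
    ∃ ψ : {a // ∃ b, R a b} ≃ {b // ∃ a, R a b}, ∀ a, R a.1 (ψ a).1 := by
  choose f hf using fun a : {a // ∃ b, R a b} => a.2
  refine ⟨Equiv.ofBijective (fun a => ⟨f a, a, hf a⟩) ⟨fun a a' h => ?_, ?_⟩, hf⟩
  · exact Subtype.ext (hR.1 (hf a) ((Subtype.mk.inj h).symm ▸ hf a'))
  · rintro ⟨b, a, hab⟩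
    exact ⟨⟨a, b, hab⟩, Subtype.ext (hR.2 (hf ⟨a, b, hab⟩) hab)⟩

theorem single_one_injective {ι : Type*} [DecidableEq ι] :
    Function.Injective fun j : ι => (Pi.single j 1 : ι → ℕ) := fun i j h => by
  simpa [Pi.single_apply] using congrFun h i

theorem colLen_injective : Function.Injective YoungDiagram.colLen := fun μ ν h => by
  ext ⟨i, j⟩
  simp only [YoungDiagram.mem_cells, YoungDiagram.mem_iff_lt_colLen, h]

theorem colLen_eq_iff {μ : YoungDiagram} {j n : ℕ} :
    μ.colLen j = n ↔ ∀ i, (i, j) ∈ μ ↔ i < n := by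
  simp only [YoungDiagram.mem_iff_lt_colLen]
  exact ⟨fun h i => h ▸ Iff.rfl, fun h => eq_of_forall_lt_iff h⟩

theorem exists_colLen_eq_iff {f : ℕ → ℕ} :
    (∃ μ : YoungDiagram, μ.colLen = f) ↔ Antitone f ∧ ∃ N, f N = 0 := by
  constructor
  · rintro ⟨μ, rfl⟩
    refine ⟨fun i j => μ.colLen_anti i j, μ.rowLen 0, Nat.eq_zero_of_not_pos fun h => ?_⟩
    exact lt_irrefl _ (YoungDiagram.mem_iff_lt_rowLen.1 (YoungDiagram.mem_iff_lt_colLen.2 h))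
  · rintro ⟨hf, N, hN⟩
    have hmem (i j : ℕ) : (i < f 0 ∧ j < N) ∧ i < f j ↔ i < f j := by
      refine ⟨And.right, fun h => ⟨⟨h.trans_le (hf j.zero_le), ?_⟩, h⟩⟩
      by_contra! hj
      exact absurd (hf hj) (by omega)
    refine ⟨⟨{c ∈ Finset.range (f 0) ×ˢ Finset.range N | c.1 < f c.2}, ?_⟩, ?_⟩
    · rintro ⟨a, b⟩ ⟨a', b'⟩ ⟨ha : a' ≤ a, hb : b' ≤ b⟩ hab
      simp only [Finset.coe_filter, Finset.mem_product, Finset.mem_range, hmem,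
        Set.mem_ofPred_eq] at hab ⊢
      exact ha.trans_lt (hab.trans_le (hf hb))
    · funext j
      refine colLen_eq_iff.2 fun i => ?_
      rw [← YoungDiagram.mem_cells]
      simp only [Finset.mem_filter, Finset.mem_product, Finset.mem_range, hmem]

theorem addBox_iff_colLen {μ ν : YoungDiagram} :
    AddBox μ ν ↔ ∃ j, ν.colLen = μ.colLen + Pi.single j 1 := by
  have hcells (i j : ℕ) : ν.cells = insert (i, j) μ.cells ↔
      ∀ a b, a < ν.colLen b ↔ a = i ∧ b = j ∨ a < μ.colLen b := by
    simp [Finset.ext_iff, YoungDiagram.mem_iff_lt_colLen]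
  simp only [AddBox, Prod.exists, hcells, YoungDiagram.mem_cells, YoungDiagram.mem_iff_lt_colLen]
  constructor
  · rintro ⟨i, j, hi, h⟩
    refine ⟨j, funext fun b => eq_of_forall_lt_iff fun a => ?_⟩
    have hij : i = μ.colLen j := by
      have := h i j
      have := h (μ.colLen j) j
      omega
    rw [h, hij, Pi.add_apply, Pi.single_apply]
    split_ifs with hb
    · subst hb
      omega
    · omega
  · rintro ⟨j, h⟩
    refine ⟨μ.colLen j, j, lt_irrefl _, fun a b => ?_⟩
    rw [h, Pi.add_apply, Pi.single_apply]
    split_ifs with hb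
    · subst hb
      omega
    · omega

theorem exists_colLen_eq_add_single_zero (μ : YoungDiagram) :
    ∃ ν : YoungDiagram, ν.colLen = μ.colLen + Pi.single 0 1 := by
  obtain ⟨hanti, N, hN⟩ := exists_colLen_eq_iff.1 ⟨μ, rfl⟩
  refine exists_colLen_eq_iff.2 ⟨antitone_nat_of_succ_le fun n => ?_, N + 1, ?_⟩
  · have := hanti (Nat.le_add_right n 1)
    simp only [Pi.add_apply, Pi.single_apply, Nat.succ_ne_zero, if_false]
    split_ifs <;> omega
  · have := hanti (Nat.le_add_right N 1)
    simp only [Pi.add_apply, Pi.single_apply]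
    split_ifs <;> omega

theorem exists_colLen_eq_add_single_succ_iff (μ : YoungDiagram) (j : ℕ) :
    (∃ ν : YoungDiagram, ν.colLen = μ.colLen + Pi.single (j + 1) 1) ↔
      μ.colLen (j + 1) < μ.colLen j := by
  constructor
  · rintro ⟨ν, h⟩
    have := ν.colLen_anti j (j + 1) j.le_succ
    simp only [h, Pi.add_apply, Pi.single_apply] at this
    split_ifs at this <;> omega
  · intro h
    obtain ⟨hanti, N, hN⟩ := exists_colLen_eq_iff.1 ⟨μ, rfl⟩
    refine exists_colLen_eq_iff.2 ⟨antitone_nat_of_succ_le fun n => ?_, N + j + 2, ?_⟩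
    · have := hanti (Nat.le_add_right n 1)
      rcases eq_or_ne n j with rfl | hn
      · simpa using h
      · simp only [Pi.add_apply, Pi.single_apply]
        split_ifs <;> omega
    · have := hanti (show N ≤ N + j + 2 by omega)
      simp only [Pi.add_apply, Pi.single_apply]
      split_ifs <;> omega

theorem exists_eq_colLen_add_single_iff (μ : YoungDiagram) (j : ℕ) :
    (∃ ν : YoungDiagram, μ.colLen = ν.colLen + Pi.single j 1) ↔
      μ.colLen (j + 1) < μ.colLen j := by
  constructor
  · rintro ⟨ν, h⟩
    have := ν.colLen_anti j (j + 1) j.le_succ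
    simp only [h, Pi.add_apply, Pi.single_apply]
    split_ifs <;> omega
  · intro h
    obtain ⟨hanti, N, hN⟩ := exists_colLen_eq_iff.1 ⟨μ, rfl⟩
    obtain ⟨ν, hν⟩ : ∃ ν : YoungDiagram, ν.colLen = μ.colLen - Pi.single j 1 := by
      refine exists_colLen_eq_iff.2 ⟨antitone_nat_of_succ_le fun n => ?_, N, by simp [hN]⟩
      have := hanti (Nat.le_add_right n 1)
      rcases eq_or_ne n j with rfl | hn
      · simp only [Pi.sub_apply, Pi.single_eq_same, Pi.single_apply]
        split_ifs <;> omega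
      · simp only [Pi.sub_apply, Pi.single_apply]
        split_ifs <;> omega
    refine ⟨ν, funext fun b => ?_⟩
    rw [hν]
    rcases eq_or_ne b j with rfl | hb
    · simp only [Pi.add_apply, Pi.sub_apply, Pi.single_eq_same]
      omega
    · simp [hb]

/-- A box can be removed from a column exactly if one can be added to the next column, and a box
can always be added to the first column. -/
theorem exists_equiv_addBox_self (x : YoungDiagram) :
    ∃ ψ : {r // AddBox r x ∧ AddBox r x} ⊕ {_u : PUnit.{1} // x = x} ≃
        {z // AddBox x z ∧ AddBox x z},
      (∀ r, (ψ (.inl r)).1.colLen 0 = x.colLen 0) ∧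
        ∀ h, (ψ (.inr h)).1.colLen 0 = x.colLen 0 + 1 := by
  obtain ⟨add, hadd⟩ := exists_equiv_of_biUnique
    (R := fun j (z : YoungDiagram) => z.colLen = x.colLen + Pi.single j 1)
    ⟨fun _ _ _ h h' => single_one_injective (add_left_cancel (h.symm.trans h')),
      fun _ _ _ h h' => colLen_injective (h.trans h'.symm)⟩
  obtain ⟨remove, -⟩ := exists_equiv_of_biUnique
    (R := fun j (r : YoungDiagram) => x.colLen = r.colLen + Pi.single j 1)
    ⟨fun _ _ _ h h' => single_one_injective (add_left_cancel (h.symm.trans h')),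
      fun _ _ _ h h' => colLen_injective (add_right_cancel (h.symm.trans h'))⟩
  have hsucc (j : ℕ) : (∃ z : YoungDiagram, z.colLen = x.colLen + Pi.single (j + 1) 1) ↔
      ∃ r : YoungDiagram, x.colLen = r.colLen + Pi.single j 1 :=
    (exists_colLen_eq_add_single_succ_iff x j).trans (exists_eq_colLen_add_single_iff x j).symm
  let shift : {j // ∃ r : YoungDiagram, x.colLen = r.colLen + Pi.single j 1} ⊕
      {_u : PUnit.{1} // x = x} ≃ {j // ∃ z : YoungDiagram, z.colLen = x.colLen + Pi.single j 1} :=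
    { toFun := Sum.elim (fun j => ⟨j.1 + 1, (hsucc j.1).2 j.2⟩)
        fun _ => ⟨0, exists_colLen_eq_add_single_zero x⟩
      invFun
        | ⟨0, _⟩ => .inr ⟨⟨⟩, rfl⟩
        | ⟨j + 1, h⟩ => .inl ⟨j, (hsucc j).1 h⟩
      left_inv := by rintro (j | u) <;> rfl
      right_inv := by rintro ⟨_ | j, h⟩ <;> rfl }
  refine ⟨(Equiv.sumCongr ((Equiv.subtypeEquivRight fun r => ?_).trans remove.symm)
    (.refl _)).trans (shift.trans (add.trans (Equiv.subtypeEquivRight fun z => ?_))), ?_, ?_⟩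
  · rw [and_self, addBox_iff_colLen]
  · rw [and_self, addBox_iff_colLen]
  · exact fun r => (congrFun (hadd _) 0).trans (by simp [shift])
  · exact fun h => (congrFun (hadd _) 0).trans (by simp [shift])

theorem addBox_iff_le_and_card {μ ν : YoungDiagram} :
    AddBox μ ν ↔ μ ≤ ν ∧ ν.card = μ.card + 1 := by
  rw [← YoungDiagram.cells_subset_iff]
  constructor
  · rintro ⟨c, hc, h⟩
    rw [YoungDiagram.card, h]
    exact ⟨Finset.subset_insert _ _, Finset.card_insert_of_notMem hc⟩
  · rintro ⟨hsub, hcard⟩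
    obtain ⟨c, hc, h⟩ := (Finset.covBy_iff_card_sdiff_eq_one.2 ⟨hsub, by
      rw [Finset.card_sdiff_of_subset hsub]
      exact Nat.sub_eq_of_eq_add' hcard⟩).exists_finset_insert
    exact ⟨c, hc, h.symm⟩

theorem eq_of_le_of_card_le {μ ν : YoungDiagram} (h : μ ≤ ν) (hcard : ν.card ≤ μ.card) : μ = ν :=
  YoungDiagram.ext (Finset.eq_of_subset_of_card_le (YoungDiagram.cells_subset_iff.2 h) hcard)

theorem eq_sup_of_addBox {x y z : YoungDiagram} (hne : x ≠ y) (hx : AddBox x z) (hy : AddBox y z) :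
    z = x ⊔ y := by
  rw [addBox_iff_le_and_card] at hx hy
  refine (eq_of_le_of_card_le (sup_le hx.1 hy.1) ?_).symm
  by_contra! h
  exact hne ((eq_of_le_of_card_le le_sup_left (by omega)).trans
    (eq_of_le_of_card_le le_sup_right (by omega)).symm)

theorem eq_inf_of_addBox {x y r : YoungDiagram} (hne : x ≠ y) (hx : AddBox r x) (hy : AddBox r y) :
    r = x ⊓ y := by
  rw [addBox_iff_le_and_card] at hx hy
  refine eq_of_le_of_card_le (le_inf hx.1 hy.1) ?_
  by_contra! h
  exact hne ((eq_of_le_of_card_le inf_le_left (by omega)).symm.trans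
    (eq_of_le_of_card_le inf_le_right (by omega)))

theorem addBox_inf_iff_addBox_sup {x y : YoungDiagram} :
    AddBox (x ⊓ y) x ∧ AddBox (x ⊓ y) y ↔ AddBox x (x ⊔ y) ∧ AddBox y (x ⊔ y) := by
  have hcard : (x ⊔ y).card + (x ⊓ y).card = x.card + y.card := by
    simp only [YoungDiagram.card, YoungDiagram.cells_sup, YoungDiagram.cells_inf]
    exact Finset.card_union_add_card_inter _ _
  simp only [addBox_iff_le_and_card, inf_le_left, inf_le_right, le_sup_left, le_sup_right, true_and]
  omega

theorem colLen_sup (μ ν : YoungDiagram) (j : ℕ) :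
    (μ ⊔ ν).colLen j = max (μ.colLen j) (ν.colLen j) := by
  refine colLen_eq_iff.2 fun i => ?_
  rw [YoungDiagram.mem_sup, YoungDiagram.mem_iff_lt_colLen, YoungDiagram.mem_iff_lt_colLen,
    lt_max_iff]

theorem exists_equiv_addBox_of_ne {x y : YoungDiagram} (hne : x ≠ y) :
    ∃ ψ : {r // AddBox r x ∧ AddBox r y} ≃ {z // AddBox x z ∧ AddBox y z},
      ∀ r, (ψ r).1.colLen 0 = max (x.colLen 0) (y.colLen 0) :=
  ⟨{ toFun r := ⟨x ⊔ y, addBox_inf_iff_addBox_sup.1 (eq_inf_of_addBox hne r.2.1 r.2.2 ▸ r.2)⟩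
     invFun z := ⟨x ⊓ y, addBox_inf_iff_addBox_sup.2 (eq_sup_of_addBox hne z.2.1 z.2.2 ▸ z.2)⟩
     left_inv r := Subtype.ext (eq_inf_of_addBox hne r.2.1 r.2.2).symm
     right_inv z := Subtype.ext (eq_sup_of_addBox hne z.2.1 z.2.2).symm },
    fun _ => colLen_sup x y 0⟩

/-- The one-row shape `(m)`. -/
def rowDiagram (m : ℕ) : YoungDiagram where
  cells := {0} ×ˢ Finset.range m
  isLowerSet := by
    rintro ⟨a, b⟩ ⟨a', b'⟩ ⟨ha : a' ≤ a, hb : b' ≤ b⟩ hab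
    simp only [SetLike.mem_coe, Finset.mem_product, Finset.mem_singleton, Finset.mem_range]
      at hab ⊢
    omega

theorem mem_rowDiagram {m i j : ℕ} : (i, j) ∈ rowDiagram m ↔ i = 0 ∧ j < m := by
  rw [← YoungDiagram.mem_cells]
  simp [rowDiagram, and_comm, eq_comm]

theorem colLen_rowDiagram (m j : ℕ) : (rowDiagram m).colLen j = if j < m then 1 else 0 := by
  refine colLen_eq_iff.2 fun i => ?_
  rw [mem_rowDiagram]
  split_ifs <;> omega

theorem rowDiagram_zero : rowDiagram 0 = ⊥ := by
  ext ⟨i, j⟩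
  simp [mem_rowDiagram]

theorem addBox_rowDiagram_iff (x : YoungDiagram) (m : ℕ) :
    AddBox x (rowDiagram m) ↔ ∃ p, m = p + 1 ∧ x = rowDiagram p := by
  simp only [addBox_iff_colLen, ← colLen_injective.eq_iff (b := rowDiagram _), funext_iff,
    Pi.add_apply, Pi.single_apply, colLen_rowDiagram]
  constructor
  · rintro ⟨p, h⟩
    have hm : m = p + 1 := by
      have := h p
      have := h (p + 1)
      have := x.colLen_anti p (p + 1) p.le_succ
      simp only [if_true, Nat.succ_ne_self, if_false] at *
      split_ifs at * <;> omega
    refine ⟨p, hm, fun j => ?_⟩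
    have := h j
    split_ifs at * <;> omega
  · rintro ⟨p, rfl, h⟩
    refine ⟨p, fun j => ?_⟩
    rw [h]
    split_ifs <;> omega

theorem growthRule_addBox : GrowthRule AddBox (fun μ => μ.colLen 0) rowDiagram where
  exists_equiv x y := by
    rcases eq_or_ne x y with rfl | hne
    · simpa only [max_self] using exists_equiv_addBox_self x
    · have : IsEmpty {_u : PUnit.{1} // x = y} := ⟨fun h => hne h.2⟩
      obtain ⟨ψ, hψ⟩ := exists_equiv_addBox_of_ne hne
      exact ⟨(Equiv.sumEmpty _ _).trans ψ, hψ, isEmptyElim⟩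
  up_iff := addBox_rowDiagram_iff
  stat_eq p := by
    rw [colLen_rowDiagram]
    split_ifs <;> omega

/-! ### Hesitating sequences as paths -/

/-- The kind of a vertex of an open partition diagram: the left endpoint of an arc only, the right
endpoint of an arc only, or both, where a loop has two endpoints and an open arc has one. The three
kinds of vertices correspond to the three forms of pairs of moves of a hesitating sequence. -/
inductive Kind
  | opener
  | closer
  | both
  deriving DecidableEq

namespace Kind

/-- The pairs of moves of a hesitating sequence that correspond to a kind. -/
def Step {α : Type*} (up : α → α → Prop) : Kind → α → α → α → Prop
  | opener, x, y, z => y = x ∧ up y z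
  | closer, x, y, z => up y x ∧ z = y
  | both, x, y, z => up x y ∧ up z y

/-- The endpoints at a vertex `i` of the given kind, each followed by a check. The left endpoint
comes first, so that a loop at `i` is an arc like any other one. -/
def tokens {I : Type*} (k : ℕ) (i : I) : Kind → List (Token I (WithTop I))
  | opener => [.left i, .check k]
  | closer => [.right i, .check k]
  | both => [.left i, .check k, .right i, .check k]

end Kind

/-- The word of the vertices `l` whose kinds are given by `t`. -/
def kindWord {I : Type*} (k : ℕ) (t : I → Kind) (l : List I) : List (Token I (WithTop I)) :=
  l.flatMap fun i => (t i).tokens k i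

/-- The hesitating sequences from `x` to `y` whose pairs of moves have the kinds `t`, with
statistic at most `k`. -/
def kindSequences {α : Type*} (up : α → α → Prop) (s : α → ℕ) (k : ℕ) {n : ℕ} (t : Fin n → Kind)
    (x y : α) : Set (Fin (2 * n + 1) → α) :=
  {f | f 0 = x ∧ f (Fin.last _) = y ∧ (∀ i, s (f i) ≤ k) ∧
    ∀ i : Fin n, (t i).Step up (f ⟨2 * i, by omega⟩) (f ⟨2 * i + 1, by omega⟩)
      (f ⟨2 * i + 2, by omega⟩)}

section Sequences

variable {I : Type*} {α : Type*} {up : α → α → Prop} {s : α → ℕ} {k : ℕ}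

/-- Split off the first pair of moves of a sequence. -/
def kindSequencesConsEquiv {n : ℕ} (t : Fin (n + 1) → Kind) {x : α} (hx : s x ≤ k) (y : α) :
    kindSequences up s k t x y ≃
      Σ p : {p : α × α // (t 0).Step up x p.1 p.2 ∧ s p.1 ≤ k ∧ s p.2 ≤ k},
        kindSequences up s k (fun i => t i.succ) p.1.2 y where
  toFun := fun ⟨f, h₀, hlast, hs, hf⟩ =>
    ⟨⟨(f ⟨1, by omega⟩, f ⟨2, by omega⟩), h₀ ▸ hf 0, hs _, hs _⟩,
      fun i => f ⟨i + 2, by omega⟩, rfl, hlast, fun _ => hs _, fun i => hf i.succ⟩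
  invFun := fun ⟨⟨p, hp, hs₁, _⟩, g, h₀, hlast, hs, hg⟩ =>
    ⟨Fin.cons x (Fin.cons p.1 g : Fin (2 * n + 2) → α), rfl, hlast,
      Fin.cases hx (Fin.cases hs₁ hs), Fin.cases (show (t 0).Step up x p.1 (g 0) from h₀ ▸ hp) hg⟩
  left_inv := fun ⟨_, h₀, _, _, _⟩ =>
    Subtype.ext <| funext <| Fin.cases h₀.symm <| Fin.cases rfl fun _ => rfl
  right_inv := fun ⟨⟨⟨_, _⟩, _, _, _⟩, _, h₀, _, _, _⟩ => by
    dsimp only at h₀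
    subst h₀
    rfl

/-- Split off the first vertex of the word of a path. -/
def Path.kindEquiv (i : I) (w : List (Token I (WithTop I))) {x : α} (hx : s x ≤ k) (y : α) :
    ∀ t : Kind, Path up s (t.tokens k i ++ w) x y ≃
      Σ p : {p : α × α // t.Step up x p.1 p.2 ∧ s p.1 ≤ k ∧ s p.2 ≤ k}, Path up s w p.1.2 y
  | .opener =>
    { toFun := fun ⟨z, p, hz⟩ => ⟨⟨(x, z), ⟨rfl, z.2⟩, hx, Int.ofNat_le.1 hz⟩, p⟩
      invFun := fun ⟨⟨⟨_, z⟩, h, _, hz⟩, p⟩ => ⟨⟨z, h.1 ▸ h.2⟩, p, Int.ofNat_le.2 hz⟩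
      left_inv := fun _ => rfl
      right_inv := fun ⟨⟨⟨_, _⟩, ⟨h, _⟩, _, _⟩, _⟩ => by
        dsimp only at h
        subst h
        rfl }
  | .closer =>
    { toFun := fun ⟨z, p, hz⟩ =>
        ⟨⟨(z, z), ⟨z.2, rfl⟩, Int.ofNat_le.1 hz, Int.ofNat_le.1 hz⟩, p⟩
      invFun := fun ⟨⟨⟨_, z⟩, h, _, hz⟩, p⟩ =>
        ⟨⟨z, h.2.symm.subst (motive := (up · x)) h.1⟩, p, Int.ofNat_le.2 hz⟩
      left_inv := fun _ => rfl
      right_inv := fun ⟨⟨⟨_, _⟩, ⟨_, h⟩, _, _⟩, _⟩ => by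
        dsimp only at h
        subst h
        rfl }
  | .both =>
    { toFun := fun ⟨z, ⟨z', p, hz'⟩, hz⟩ =>
        ⟨⟨(z, z'), ⟨z.2, z'.2⟩, Int.ofNat_le.1 hz, Int.ofNat_le.1 hz'⟩, p⟩
      invFun := fun ⟨⟨⟨z, z'⟩, h, hz, hz'⟩, p⟩ =>
        ⟨⟨z, h.1⟩, ⟨⟨z', h.2⟩, p, Int.ofNat_le.2 hz'⟩, Int.ofNat_le.2 hz⟩
      left_inv := fun _ => rfl
      right_inv := fun ⟨⟨⟨_, _⟩, _, _, _⟩, _⟩ => rfl }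

theorem nonempty_kindSequences_equiv_path {n : ℕ} (t : I → Kind) (v : Fin n → I) {x : α}
    (hx : s x ≤ k) (y : α) :
    Nonempty (kindSequences up s k (fun i => t (v i)) x y ≃
      Path up s (kindWord k t (List.ofFn v)) x y) := by
  induction n generalizing x with
  | zero =>
    exact ⟨fun f => ⟨⟨⟩, f.2.1.symm.trans f.2.2.1⟩,
      fun h => ⟨fun _ => x, rfl, h.2, fun _ => hx, fun i => i.elim0⟩,
      fun f => Subtype.ext <| funext fun i => f.2.1.symm.trans <|
        congrArg f.1 (Subsingleton.elim (α := Fin 1) 0 i), fun _ => rfl⟩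
  | succ n ih =>
    rw [List.ofFn_succ]
    exact ⟨(kindSequencesConsEquiv (fun i => t (v i)) hx y).trans <|
      (Equiv.sigmaCongrRight fun p => (ih (fun i => v i.succ) p.2.2.2).some).trans
        (Path.kindEquiv (v 0) _ hx y (t (v 0))).symm⟩

end Sequences

theorem isHesitating_iff {α : Type} {up : α → α → Prop} {n : ℕ} {f : Fin (2 * n + 1) → α} :
    IsHesitating up f ↔ ∃ t : Fin n → Kind, ∀ i : Fin n, (t i).Step up (f ⟨2 * i, by omega⟩)
      (f ⟨2 * i + 1, by omega⟩) (f ⟨2 * i + 2, by omega⟩) := by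
  rw [← Classical.skolem (p := fun (i : Fin n) t => Kind.Step up t (f ⟨2 * i, by omega⟩)
    (f ⟨2 * i + 1, by omega⟩) (f ⟨2 * i + 2, by omega⟩))]
  refine forall_congr' fun i => ⟨?_, ?_⟩
  · rintro (h | h | h)
    exacts [⟨.opener, h⟩, ⟨.closer, h⟩, ⟨.both, h⟩]
  · rintro ⟨_ | _ | _, h⟩
    exacts [.inl h, .inr (.inl h), .inr (.inr h)]

theorem Kind.eq_of_step {α : Type*} {up : α → α → Prop} (hup : ∀ x, ¬ up x x) {t t' : Kind}
    {x y z : α} (h : t.Step up x y z) (h' : t'.Step up x y z) : t = t' := by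
  cases t <;> cases t' <;> simp only [Kind.Step] at h h' <;> grind

theorem not_addBox_self (μ : YoungDiagram) : ¬ AddBox μ μ := fun h =>
  (addBox_iff_le_and_card.1 h).2.not_lt (Nat.lt_succ_self _)

theorem nonempty_tableaux_equiv_sigma_kindSequences (k n m : ℕ) :
    Nonempty (tableaux k n m ≃ Σ t : Fin n → Kind,
      kindSequences AddBox (fun μ => μ.colLen 0) k t (rowDiagram 0) (rowDiagram m)) := by
  refine ⟨.symm <| .ofBijective (fun f => ⟨f.2.1, isHesitating_iff.2 ⟨f.1, f.2.2.2.2.2⟩,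
    f.2.2.1.trans rowDiagram_zero, f.2.2.2.2.1, congrArg YoungDiagram.cells f.2.2.2.1⟩) ⟨?_, ?_⟩⟩
  · rintro ⟨t, f, hf⟩ ⟨t', f', hf'⟩ h
    obtain rfl : f = f' := congrArg Subtype.val h
    have ht i : t i = t' i := Kind.eq_of_step not_addBox_self (hf.2.2.2 i) (hf'.2.2.2 i)
    exact Sigma.subtype_ext (funext ht) rfl
  · rintro ⟨f, hf, h₀, hs, hlast⟩
    obtain ⟨t, ht⟩ := isHesitating_iff.1 hf
    exact ⟨⟨t, f, h₀.trans rowDiagram_zero.symm, YoungDiagram.ext hlast, hs, ht⟩, rfl⟩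

theorem nonempty_tableaux_equiv_sigma_path (k n m : ℕ) :
    Nonempty (tableaux k n m ≃ Σ t : Fin n → Kind, Path AddBox (fun μ => μ.colLen 0)
      (kindWord k t (List.finRange n)) (rowDiagram 0) (rowDiagram m)) := by
  obtain ⟨e⟩ := nonempty_tableaux_equiv_sigma_kindSequences k n m
  have h₀ : (rowDiagram 0).colLen 0 ≤ k := by simp [growthRule_addBox.stat_eq 0]
  rw [← List.ofFn_id]
  exact ⟨e.trans <| Equiv.sigmaCongrRight fun t =>
    (nonempty_kindSequences_equiv_path (s := fun μ : YoungDiagram => μ.colLen 0) t id h₀ _).some⟩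

/-! ### Fillings of the words of kinds -/

section Kinds

variable {I : Type*} {k : ℕ} {t : I → Kind}

theorem kindWord_append (l₁ l₂ : List I) :
    kindWord k t (l₁ ++ l₂) = kindWord k t l₁ ++ kindWord k t l₂ :=
  List.flatMap_append

theorem kindWord_cons (i : I) (l : List I) :
    kindWord k t (i :: l) = (t i).tokens k i ++ kindWord k t l :=
  List.flatMap_cons

theorem lefts_kindWord (l : List I) : lefts (kindWord k t l) = l.filter (t · ≠ .closer) := by
  induction l with
  | nil => rfl
  | cons i l ih =>
    rw [kindWord_cons, lefts_append, ih]
    cases h : t i <;> simp [Kind.tokens, h]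

theorem rights_kindWord (l : List I) :
    rights (kindWord k t l) = (l.filter (t · ≠ .opener)).map (↑) := by
  induction l with
  | nil => rfl
  | cons i l ih =>
    rw [kindWord_cons, rights_append, ih]
    cases h : t i <;> simp [Kind.tokens, h]

variable [LinearOrder I]

theorem isSorted_kindWord {l : List I} (hl : l.Pairwise (· < ·)) : IsSorted (kindWord k t l) := by
  rw [IsSorted, lefts_kindWord, rights_kindWord]
  refine ⟨hl.filter _, List.pairwise_append.2
    ⟨(hl.filter _).map _ fun _ _ => WithTop.coe_lt_coe.2, List.pairwise_singleton _ _, ?_⟩⟩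
  simp only [List.mem_map, List.mem_singleton]
  rintro _ ⟨j, -, rfl⟩ _ rfl
  exact WithTop.coe_lt_top j

variable {F : Set (I × WithTop I)} {A : List I} {B : List (WithTop I)}

theorem exists_mem_of_valid_tokens {i : I} {c : Kind} (h : Valid F A B (c.tokens k i))
    (hc : c ≠ .opener) : ∃ a, (a ∈ A ∨ a = i) ∧ (a, (i : WithTop I)) ∈ F := by
  cases c <;> simp_all [Kind.tokens, Valid]

theorem nestingBound_of_valid_tokens {i : I} {c : Kind} (h : Valid F A B (c.tokens k i))
    (hc : c ≠ .closer) :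
    NestingBound {p ∈ F | (p.1 ∈ A ∨ p.1 = i) ∧ (p.2 = i ∧ c ≠ .opener ∨ p.2 ∈ B)} k := by
  cases c <;> simp_all [Kind.tokens, Valid]

theorem valid_tokens {i : I} {c : Kind} (hF : NestingBound F k)
    (h : c ≠ .opener → ∃ a ∈ A ++ lefts (c.tokens k i), (a, (i : WithTop I)) ∈ F) :
    Valid F A B (c.tokens k i) := by
  have hcheck (p : I × WithTop I → Prop) : NestingBound {q ∈ F | p q} k :=
    hF.mono (Set.sep_subset F p)
  cases c
  · exact ⟨hcheck _, trivial⟩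
  · exact ⟨by simpa [Kind.tokens] using h, hcheck _, trivial⟩
  · exact ⟨hcheck _, by simpa [Kind.tokens] using h, hcheck _, trivial⟩

theorem valid_kindWord {l : List I} (hl : l.Pairwise (· < ·)) (hF : NestingBound F k)
    (h : ∀ j ∈ l, t j ≠ .opener →
      ∃ i ≤ j, (i, (j : WithTop I)) ∈ F ∧ i ∈ A ++ lefts (kindWord k t l)) :
    Valid F A B (kindWord k t l) := by
  induction l generalizing A with
  | nil => trivial
  | cons i l ih =>
    rw [List.pairwise_cons] at hl
    rw [kindWord_cons] at h ⊢
    rw [valid_append]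
    refine ⟨valid_tokens hF fun hi => ?_, ih hl.2 fun j hj hjo => ?_⟩
    · obtain ⟨a, hai, haF, ha⟩ := h i List.mem_cons_self hi
      have : a ∉ lefts (kindWord k t l) := fun ha =>
        (hl.1 a (List.mem_of_mem_filter (lefts_kindWord (k := k) l ▸ ha))).not_ge hai
      exact ⟨a, by simpa [this] using ha, haF⟩
    · simpa using h j (List.mem_cons_of_mem i hj) hjo

theorem exists_le_mem_of_valid_kindWord {l : List I} (hl : l.Pairwise (· < ·))
    (h : Valid F [] B (kindWord k t l)) {j : I} (hj : j ∈ l) (hjo : t j ≠ .opener) :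
    ∃ i ≤ j, (i, (j : WithTop I)) ∈ F := by
  obtain ⟨l₁, l₂, rfl⟩ := List.append_of_mem hj
  rw [kindWord_append, kindWord_cons, valid_append, valid_append] at h
  obtain ⟨i, hi, hF⟩ := exists_mem_of_valid_tokens h.2.1 hjo
  refine ⟨i, hi.elim (fun hi => ?_) Eq.le, hF⟩
  rw [List.nil_append, lefts_kindWord] at hi
  exact ((List.pairwise_append.1 hl).2.2 i (List.mem_of_mem_filter hi) j List.mem_cons_self).le

theorem nestingBound_of_valid_kindWord {l : List I} (hl : l.Pairwise (· < ·))
    (h : Valid F [] [⊤] (kindWord k t l)) {i : I} (hi : i ∈ l) (hic : t i ≠ .closer) :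
    NestingBound {p ∈ F | p.1 ∈ lefts (kindWord k t l) ∧ p.1 ≤ i ∧
      p.2 ∈ rights (kindWord k t l) ++ [⊤] ∧ i ≤ p.2} k := by
  obtain ⟨l₁, l₂, rfl⟩ := List.append_of_mem hi
  rw [kindWord_append, kindWord_cons, valid_append, valid_append] at h
  refine (nestingBound_of_valid_tokens h.2.1 hic).mono ?_
  obtain ⟨-, hl₂, hl₁⟩ := List.pairwise_append.1 hl
  rw [List.pairwise_cons] at hl₂
  rintro ⟨a, b⟩ ⟨hF, ha, hai, hb, hib⟩
  simp only [lefts_kindWord, rights_kindWord] at ha hb ⊢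
  refine ⟨hF, ?_, ?_⟩
  · grind
  · induction b using WithTop.recTopCoe with
    | top => simp
    | coe b =>
      rw [WithTop.coe_le_coe] at hib
      simp at hb ⊢
      grind

/-- The set `F` consists of the arcs of a diagram with vertices of the kinds `t`: the pair
`(i, j)` is a closed arc if `i < j`, a loop if `i = j`, and an open arc if `j = ⊤`. -/
structure IsArcSet (t : I → Kind) (F : Set (I × WithTop I)) : Prop where
  le : ∀ i b, (i, b) ∈ F → (i : WithTop I) ≤ b
  exists_right_iff : ∀ i, (∃ b, (i, b) ∈ F) ↔ t i ≠ .closer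
  exists_left_iff : ∀ j : I, (∃ i, (i, (j : WithTop I)) ∈ F) ↔ t j ≠ .opener
  left_unique : ∀ i b b', (i, b) ∈ F → (i, b') ∈ F → b = b'
  right_unique : ∀ i i' (j : I), (i, (j : WithTop I)) ∈ F → (i', (j : WithTop I)) ∈ F → i = i'

variable {l : List I} {m : ℕ}

theorem Filling.isArcSet (hl : l.Pairwise (· < ·)) (hmem : ∀ i, i ∈ l)
    (h : Filling (kindWord k t l) m F) : IsArcSet t F := by
  have hlefts i : i ∈ lefts (kindWord k t l) ↔ t i ≠ .closer := by simp [lefts_kindWord, hmem]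
  have hrights (j : I) : (j : WithTop I) ∈ rights (kindWord k t l) ++ [⊤] ↔ t j ≠ .opener := by
    simp [rights_kindWord, hmem]
  have right_unique i i' (j : I) : (i, (j : WithTop I)) ∈ F → (i', (j : WithTop I)) ∈ F → i = i' :=
    h.right_unique i i' j WithTop.coe_ne_top
  have exists_left_le (j : I) (hj : t j ≠ .opener) : ∃ i ≤ j, (i, (j : WithTop I)) ∈ F :=
    exists_le_mem_of_valid_kindWord hl h.valid (hmem j) hj
  refine
    { le := fun i b hib => ?_
      exists_right_iff := fun i =>
        ⟨fun ⟨b, hb⟩ => (hlefts i).1 (h.mem_lefts _ hb), fun hi =>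
          h.exists_right i ((hlefts i).2 hi)⟩
      exists_left_iff := fun j =>
        ⟨fun ⟨i, hi⟩ => (hrights j).1 (h.mem_rights _ hi), fun hj =>
          (exists_left_le j hj).imp fun _ => And.right⟩
      left_unique := h.left_unique
      right_unique := right_unique }
  induction b using WithTop.recTopCoe with
  | top => exact le_top
  | coe j =>
    obtain ⟨a, haj, ha⟩ := exists_left_le j ((hrights j).1 (h.mem_rights _ hib))
    exact right_unique i a j hib ha ▸ WithTop.coe_le_coe.2 haj

theorem Filling.nestingBound (hl : l.Pairwise (· < ·)) (hmem : ∀ i, i ∈ l)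
    (h : Filling (kindWord k t l) m F) : NestingBound F k := by
  have hF := h.isArcSet hl hmem
  intro S hS hchain
  rcases S.eq_empty_or_nonempty with rfl | hne
  · simp
  -- The check that follows the rightmost left endpoint of a nesting bounds the whole nesting.
  obtain ⟨p, hp, hmax⟩ := S.exists_max_image Prod.fst hne
  refine nestingBound_of_valid_kindWord hl h.valid (hmem p.1)
    ((hF.exists_right_iff p.1).1 ⟨p.2, hS hp⟩) S (fun q hq => ?_) hchain
  have hpq : p.2 ≤ q.2 := by
    rcases eq_or_ne q p with rfl | hqp
    · exact le_rfl
    · exact ((hchain hq hp hqp).resolve_right fun h => (hmax q hq).not_gt h.1).2.le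
  exact ⟨hS hq, h.mem_lefts q (hS hq), hmax q hq, h.mem_rights q (hS hq),
    (hF.le p.1 p.2 (hS hp)).trans hpq⟩

theorem filling_kindWord_iff (hl : l.Pairwise (· < ·)) (hmem : ∀ i, i ∈ l) :
    Filling (kindWord k t l) m F ↔
      IsArcSet t F ∧ NestingBound F k ∧ {i | (i, (⊤ : WithTop I)) ∈ F}.ncard = m := by
  refine ⟨fun h => ⟨h.isArcSet hl hmem, h.nestingBound hl hmem, h.ncard_top⟩,
    fun ⟨hF, hk, hm⟩ => ?_⟩
  have hlefts i : i ∈ lefts (kindWord k t l) ↔ ∃ b, (i, b) ∈ F := by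
    simp [lefts_kindWord, hmem, hF.exists_right_iff]
  refine ⟨fun p hp => (hlefts p.1).2 ⟨p.2, hp⟩, fun ⟨i, b⟩ hib => ?_, fun i hi => (hlefts i).1 hi,
    hF.left_unique, fun i i' b hb => ?_, hm, valid_kindWord hl hk fun j _ hj => ?_⟩
  · induction b using WithTop.recTopCoe with
    | top => simp
    | coe j => simpa [rights_kindWord, hmem] using (hF.exists_left_iff j).1 ⟨i, hib⟩
  · lift b to I using hb
    exact hF.right_unique i i' b
  · obtain ⟨i, hi⟩ := (hF.exists_left_iff j).2 hj
    exact ⟨i, WithTop.coe_le_coe.1 (hF.le i j hi), hi, by simpa using (hlefts i).2 ⟨_, hi⟩⟩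

end Kinds

/-! ### Open partition diagrams as fillings -/

theorem nestingBound_iff_not_exists {I J : Type*} [LinearOrder I] [LinearOrder J]
    {F : Set (I × J)} {l : ℕ} :
    NestingBound F l ↔ ¬ ∃ (a : Fin (l + 1) → I) (b : Fin (l + 1) → J),
      StrictMono a ∧ StrictAnti b ∧ ∀ r, (a r, b r) ∈ F := by
  classical
  constructor
  · rintro h ⟨a, b, ha, hb, hF⟩
    have hinj : Function.Injective fun r => (a r, b r) := fun r r' hr =>
      ha.injective (congrArg Prod.fst hr)
    have hcard := h (Finset.univ.image fun r => (a r, b r)) (by simpa [Set.range_subset_iff]) ?_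
    · rw [Finset.card_image_of_injective _ hinj] at hcard
      simp at hcard
    · rw [Finset.coe_image, Finset.coe_univ, Set.image_univ]
      rintro _ ⟨r, rfl⟩ _ ⟨r', rfl⟩ hne
      exact (lt_or_gt_of_ne fun hr => hne (by rw [hr])).imp
        (fun hr => ⟨ha hr, hb hr⟩) fun hr => ⟨ha hr, hb hr⟩
  · intro h S hS hchain
    by_contra! hcard
    obtain ⟨T, hTS, hT⟩ := Finset.exists_subset_card_eq (s := S) (n := l + 1) (by omega)
    have nests {p q} (hp : p ∈ T) (hq : q ∈ T) (hpq : p.1 < q.1) : Nests p q :=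
      (hchain (hTS hp) (hTS hq) fun h => hpq.ne (congrArg Prod.fst h)).resolve_right
        fun h => h.1.not_gt hpq
    have hinj : Set.InjOn Prod.fst (T : Set (I × J)) := fun p hp q hq hpq => by
      by_contra hne
      exact (hchain (hTS hp) (hTS hq) hne).elim (fun h => h.1.ne hpq) fun h => h.1.ne hpq.symm
    let a := (T.image Prod.fst).orderEmbOfFin ((Finset.card_image_of_injOn hinj).trans hT)
    have hex r : ∃ b, (a r, b) ∈ T := by
      obtain ⟨p, hp, hpr⟩ := Finset.mem_image.1 (Finset.orderEmbOfFin_mem _ _ r : a r ∈ _)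
      exact ⟨p.2, hpr ▸ hp⟩
    choose b hb using hex
    exact h ⟨a, b, a.strictMono, fun r r' hr => (nests (hb r) (hb r') (a.strictMono hr)).2,
      fun r => hS (hTS (hb r))⟩

theorem strictMono_finCons {β : Type*} [Preorder β] {l : ℕ} {x : β} {f : Fin l → β} :
    StrictMono (Fin.cons x f : Fin (l + 1) → β) ↔ (∀ r, x < f r) ∧ StrictMono f := by
  simp [StrictMono, Fin.forall_fin_succ]

theorem strictAnti_finCons {β : Type*} [Preorder β] {l : ℕ} {x : β} {f : Fin l → β} :
    StrictAnti (Fin.cons x f : Fin (l + 1) → β) ↔ (∀ r, f r < x) ∧ StrictAnti f := by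
  simp [StrictAnti, Fin.forall_fin_succ]

theorem Kind.exists_iff_ne {p q : Prop} (h : p ∨ q) :
    ∃ c : Kind, (p ↔ c ≠ .closer) ∧ (q ↔ c ≠ .opener) := by
  by_cases hp : p
  · by_cases hq : q
    · exact ⟨.both, by simp [hp], by simp [hq]⟩
    · exact ⟨.opener, by simp [hp], by simp [hq]⟩
  · exact ⟨.closer, by simp [hp], by simp [h.resolve_left hp]⟩

namespace OpenPartitionDiagram

variable {n : ℕ}

/-- The closed arcs and loops of a diagram, together with its open arcs, which are given the right
end `⊤`. In this way a future enhanced nesting is a nesting like any other one. -/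
def arcSet (D : OpenPartitionDiagram n) : Set (Fin n × WithTop (Fin n)) :=
  {p | (p.2 = ⊤ ∧ p.1 ∈ D.openArcs) ∨ ∃ j : Fin n, p.2 = j ∧ D.EnhancedArc p.1 j}

variable {D : OpenPartitionDiagram n}

@[simp]
theorem mem_arcSet_top {i : Fin n} : (i, ⊤) ∈ D.arcSet ↔ i ∈ D.openArcs := by
  simp [arcSet]

@[simp]
theorem mem_arcSet_coe {i j : Fin n} : (i, (j : WithTop (Fin n))) ∈ D.arcSet ↔
    D.EnhancedArc i j := by
  simp [arcSet]

theorem EnhancedArc.le {i j : Fin n} (h : D.EnhancedArc i j) : i ≤ j :=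
  h.elim (fun h => (D.lt_of_mem i j h).le) fun h => h.1.le

theorem exists_isEnhancedNesting_iff {l : ℕ} {a : Fin l → Fin n} :
    (∃ b, D.IsEnhancedNesting a b) ↔ StrictMono a ∧ ∃ b : Fin l → WithTop (Fin n),
      StrictAnti b ∧ ∀ r, b r < ⊤ ∧ (a r, b r) ∈ D.arcSet := by
  constructor
  · rintro ⟨b, ha, hb, h⟩
    exact ⟨ha, fun r => b r, WithTop.coe_strictMono.comp_strictAnti hb,
      fun r => ⟨WithTop.coe_lt_top _, mem_arcSet_coe.2 (h r).2⟩⟩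
  · rintro ⟨ha, b, hb, h⟩
    lift b to Fin l → Fin n using fun r => (h r).1.ne
    have harc r : D.EnhancedArc (a r) (b r) := mem_arcSet_coe.1 (h r).2
    exact ⟨b, ha, fun r r' hr => WithTop.coe_lt_coe.1 (hb hr), fun r => ⟨(harc r).le, harc r⟩⟩

theorem hasFutureEnhancedNestingSucc_iff {l : ℕ} :
    D.HasFutureEnhancedNestingSucc l ↔
      ∃ (a : Fin (l + 1) → Fin n) (b : Fin (l + 1) → WithTop (Fin n)),
        StrictMono a ∧ StrictAnti b ∧ b 0 = ⊤ ∧ ∀ r, (a r, b r) ∈ D.arcSet := by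
  simp only [Fin.exists_fin_succ_pi, strictMono_finCons, strictAnti_finCons, Fin.forall_fin_succ,
    Fin.cons_zero, Fin.cons_succ]
  constructor
  · rintro ⟨o, ho, a, b, hab, hoa⟩
    obtain ⟨ha, b', hb', h⟩ := exists_isEnhancedNesting_iff.1 ⟨b, hab⟩
    exact ⟨o, a, ⊤, b', ⟨hoa, ha⟩, ⟨fun r => (h r).1, hb'⟩, rfl, mem_arcSet_top.2 ho,
      fun r => (h r).2⟩
  · rintro ⟨o, a, _, b', ⟨hoa, ha⟩, ⟨hlt, hb'⟩, rfl, ho, h⟩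
    obtain ⟨b, hab⟩ := exists_isEnhancedNesting_iff.2 ⟨ha, b', hb', fun r => ⟨hlt r, h r⟩⟩
    exact ⟨o, mem_arcSet_top.1 ho, a, b, hab, hoa⟩

theorem nestingBound_arcSet_iff {k : ℕ} : NestingBound D.arcSet k ↔
    ¬ D.HasEnhancedNesting (k + 1) ∧ ¬ D.HasFutureEnhancedNestingSucc k := by
  rw [nestingBound_iff_not_exists, ← not_or, not_iff_not, hasFutureEnhancedNestingSucc_iff]
  simp only [HasEnhancedNesting, exists_isEnhancedNesting_iff]
  constructor
  · rintro ⟨a, b, ha, hb, h⟩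
    rcases eq_or_ne (b 0) ⊤ with h₀ | h₀
    · exact .inr ⟨a, b, ha, hb, h₀, h⟩
    · exact .inl ⟨a, ha, b, hb, fun r =>
        ⟨(hb.antitone (Fin.zero_le r)).trans_lt h₀.lt_top, h r⟩⟩
  · rintro (⟨a, ha, b, hb, h⟩ | ⟨a, b, ha, hb, -, h⟩)
    · exact ⟨a, b, ha, hb, fun r => (h r).2⟩
    · exact ⟨a, b, ha, hb, h⟩

theorem arcSet_injective :
    Function.Injective (arcSet : OpenPartitionDiagram n → Set (Fin n × WithTop (Fin n))) := by
  have mem_arcs_of_eq {D D' : OpenPartitionDiagram n} (h : D.arcSet = D'.arcSet) {p}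
      (hp : p ∈ D.arcs) : p ∈ D'.arcs := by
    have harc : D'.EnhancedArc p.1 p.2 := mem_arcSet_coe.1 (h ▸ mem_arcSet_coe.2 (.inl hp))
    exact harc.resolve_right fun h => (D.lt_of_mem p.1 p.2 hp).ne h.1
  intro D D' h
  ext p
  · exact ⟨mem_arcs_of_eq h, mem_arcs_of_eq h.symm⟩
  · rw [← mem_arcSet_top, h, mem_arcSet_top]

theorem arcSet_left_unique {i : Fin n} {b b' : WithTop (Fin n)} (h : (i, b) ∈ D.arcSet)
    (h' : (i, b') ∈ D.arcSet) : b = b' := by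
  have notMem_openArcs {i j} (h : D.EnhancedArc i j) : i ∉ D.openArcs :=
    h.elim (D.not_mem_openArcs i j) fun h => h.2.1
  induction b using WithTop.recTopCoe with
  | top =>
    induction b' using WithTop.recTopCoe with
    | top => rfl
    | coe j => exact absurd (mem_arcSet_top.1 h) (notMem_openArcs (mem_arcSet_coe.1 h'))
  | coe j =>
    induction b' using WithTop.recTopCoe with
    | top => exact absurd (mem_arcSet_top.1 h') (notMem_openArcs (mem_arcSet_coe.1 h))
    | coe j' =>
      rw [mem_arcSet_coe] at h h'
      rcases h with h | ⟨rfl, h⟩ <;> rcases h' with h' | ⟨rfl, h'⟩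
      exacts [D.left_unique i j j' h h' ▸ rfl, absurd h (h'.2 _).1, absurd h' (h.2 _).1, rfl]

theorem EnhancedArc.right_unique {i i' j : Fin n} (h : D.EnhancedArc i j)
    (h' : D.EnhancedArc i' j) : i = i' := by
  rcases h with h | ⟨rfl, h⟩ <;> rcases h' with h' | ⟨rfl, h'⟩
  exacts [D.right_unique _ _ _ h h', absurd h (h'.2 _).2, absurd h' (h.2 _).2, rfl]

theorem exists_mem_arcSet (D : OpenPartitionDiagram n) (i : Fin n) :
    (∃ b, (i, b) ∈ D.arcSet) ∨ ∃ a, (a, (i : WithTop (Fin n))) ∈ D.arcSet := by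
  by_cases hi : D.IsIsolated i
  · exact .inr ⟨i, mem_arcSet_coe.2 (.inr ⟨rfl, hi⟩)⟩
  · simp only [IsIsolated, not_and_or, not_forall, not_not] at hi
    rcases hi with h | ⟨u, h | h⟩
    · exact .inl ⟨⊤, mem_arcSet_top.2 h⟩
    · exact .inl ⟨u, mem_arcSet_coe.2 (.inl h)⟩
    · exact .inr ⟨u, mem_arcSet_coe.2 (.inl h)⟩

theorem exists_isArcSet (D : OpenPartitionDiagram n) : ∃ t, IsArcSet t D.arcSet := by
  choose t hleft hright using fun i => Kind.exists_iff_ne (D.exists_mem_arcSet i)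
  refine ⟨t, fun i b hib => ?_, hleft, hright, fun i b b' => arcSet_left_unique,
    fun i i' j h h' => (mem_arcSet_coe.1 h).right_unique (mem_arcSet_coe.1 h')⟩
  induction b using WithTop.recTopCoe with
  | top => exact le_top
  | coe j => exact WithTop.coe_le_coe.2 (mem_arcSet_coe.1 hib).le

end OpenPartitionDiagram

namespace IsArcSet

variable {n : ℕ} {t : Fin n → Kind} {F : Set (Fin n × WithTop (Fin n))}

theorem kind_unique (h : IsArcSet t F) {t' : Fin n → Kind} (h' : IsArcSet t' F) : t = t' := by
  funext i
  have hleft := (h.exists_right_iff i).symm.trans (h'.exists_right_iff i)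
  have hright := (h.exists_left_iff i).symm.trans (h'.exists_left_iff i)
  cases hi : t i <;> cases hi' : t' i <;> simp_all

open Classical in
/-- The diagram with the given set of arcs. -/
noncomputable def toDiagram (h : IsArcSet t F) : OpenPartitionDiagram n where
  arcs := {p | (p.1, (p.2 : WithTop (Fin n))) ∈ F ∧ p.1 ≠ p.2}
  openArcs := {i | (i, (⊤ : WithTop (Fin n))) ∈ F}
  lt_of_mem i j hij := by
    obtain ⟨hF, hne⟩ := (Finset.mem_filter.1 hij).2
    exact (WithTop.coe_le_coe.1 (h.le i j hF)).lt_of_ne hne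
  left_unique i j j' hj hj' := WithTop.coe_inj.1
    (h.left_unique i j j' (Finset.mem_filter.1 hj).2.1 (Finset.mem_filter.1 hj').2.1)
  right_unique i i' j hi hi' :=
    h.right_unique i i' j (Finset.mem_filter.1 hi).2.1 (Finset.mem_filter.1 hi').2.1
  not_mem_openArcs i j hj htop := WithTop.coe_ne_top
    (h.left_unique i j ⊤ (Finset.mem_filter.1 hj).2.1 (Finset.mem_filter.1 htop).2)

theorem mem_arcs_toDiagram (h : IsArcSet t F) {i j : Fin n} :
    (i, j) ∈ h.toDiagram.arcs ↔ (i, (j : WithTop (Fin n))) ∈ F ∧ i ≠ j := by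
  simp [toDiagram]

theorem mem_openArcs_toDiagram (h : IsArcSet t F) {i : Fin n} :
    i ∈ h.toDiagram.openArcs ↔ (i, ⊤) ∈ F := by
  simp [toDiagram]

theorem isIsolated_toDiagram_iff (h : IsArcSet t F) {i : Fin n} :
    h.toDiagram.IsIsolated i ↔ (i, (i : WithTop (Fin n))) ∈ F := by
  simp only [OpenPartitionDiagram.IsIsolated, h.mem_arcs_toDiagram, h.mem_openArcs_toDiagram,
    not_and, not_not]
  constructor
  · rintro ⟨hopen, harcs⟩
    have eq_of_mem {b} (hb : (i, b) ∈ F) : b = i := by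
      induction b using WithTop.recTopCoe with
      | top => exact absurd hb hopen
      | coe j => exact congrArg _ ((harcs j).1 hb).symm
    rcases eq_or_ne (t i) .closer with hi | hi
    · obtain ⟨a, ha⟩ := (h.exists_left_iff i).2 (by simp [hi])
      exact (harcs a).2 ha ▸ ha
    · obtain ⟨b, hb⟩ := (h.exists_right_iff i).2 hi
      exact eq_of_mem hb ▸ hb
  · exact fun hi => ⟨fun htop => WithTop.coe_ne_top (h.left_unique _ _ _ hi htop), fun u =>
      ⟨fun hu => WithTop.coe_inj.1 (h.left_unique _ _ _ hi hu),
        fun hu => h.right_unique _ _ _ hu hi⟩⟩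

theorem arcSet_toDiagram (h : IsArcSet t F) : h.toDiagram.arcSet = F := by
  ext ⟨i, b⟩
  induction b using WithTop.recTopCoe with
  | top => rw [OpenPartitionDiagram.mem_arcSet_top, h.mem_openArcs_toDiagram]
  | coe j =>
    rw [OpenPartitionDiagram.mem_arcSet_coe, OpenPartitionDiagram.EnhancedArc,
      h.mem_arcs_toDiagram, h.isIsolated_toDiagram_iff]
    grind

end IsArcSet

theorem mem_openDiagrams_iff {k n m : ℕ} {D : OpenPartitionDiagram n} :
    D ∈ openDiagrams k n m ↔
      NestingBound D.arcSet k ∧ {i | (i, (⊤ : WithTop (Fin n))) ∈ D.arcSet}.ncard = m := by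
  have hncard : {i | (i, (⊤ : WithTop (Fin n))) ∈ D.arcSet}.ncard = D.openArcs.card := by
    simp only [OpenPartitionDiagram.mem_arcSet_top]
    exact Set.ncard_coe_finset D.openArcs
  rw [OpenPartitionDiagram.nestingBound_arcSet_iff, hncard, and_comm]
  rfl

theorem nonempty_openDiagrams_equiv_sigma_filling (k n m : ℕ) :
    Nonempty (openDiagrams k n m ≃ Σ t : Fin n → Kind,
      {F // Filling (kindWord k t (List.finRange n)) m F}) := by
  have filling_iff {t F} : Filling (kindWord k t (List.finRange n)) m F ↔ _ :=
    filling_kindWord_iff (List.pairwise_lt_finRange n) List.mem_finRange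
  choose t ht using OpenPartitionDiagram.exists_isArcSet (n := n)
  refine ⟨.ofBijective (fun D => ⟨t D, D.1.arcSet,
    filling_iff.2 ⟨ht D, mem_openDiagrams_iff.1 D.2⟩⟩) ⟨fun D D' h => ?_, ?_⟩⟩
  · exact Subtype.ext <| OpenPartitionDiagram.arcSet_injective <| congrArg (fun p :
      Σ t : Fin n → Kind, {F // Filling (kindWord k t (List.finRange n)) m F} => p.2.1) h
  · rintro ⟨t', F, hF⟩
    obtain ⟨h, hkm⟩ := filling_iff.1 hF
    refine ⟨⟨h.toDiagram, mem_openDiagrams_iff.2 (h.arcSet_toDiagram.symm ▸ hkm)⟩,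
      Sigma.subtype_ext (IsArcSet.kind_unique (ht _) ?_) h.arcSet_toDiagram⟩
    rwa [h.arcSet_toDiagram]

theorem nonempty_tableaux_equiv_openDiagrams (k n m : ℕ) :
    Nonempty (tableaux k n m ≃ openDiagrams k n m) := by
  obtain ⟨e₁⟩ := nonempty_tableaux_equiv_sigma_path k n m
  obtain ⟨e₂⟩ := nonempty_openDiagrams_equiv_sigma_filling k n m
  have e (t : Fin n → Kind) := nonempty_path_equiv_filling growthRule_addBox m
    (isSorted_kindWord (k := k) (t := t) (List.pairwise_lt_finRange n))
  exact ⟨e₁.trans <| (Equiv.sigmaCongrRight fun t => (e t).some).trans e₂.symm⟩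

/-! ### Tableaux as lattice walks -/

theorem rowLen_injective : Function.Injective YoungDiagram.rowLen := fun μ ν h => by
  ext ⟨i, j⟩
  simp only [YoungDiagram.mem_cells, YoungDiagram.mem_iff_lt_rowLen, h]

theorem addBox_transpose_iff {μ ν : YoungDiagram} :
    AddBox μ.transpose ν.transpose ↔ AddBox μ ν := by
  have hcard (κ : YoungDiagram) : κ.transpose.card = κ.card := Finset.card_map _
  simp only [addBox_iff_le_and_card, YoungDiagram.transpose_le_iff, hcard]

theorem addBox_iff_rowLen {μ ν : YoungDiagram} :
    AddBox μ ν ↔ ∃ i, ν.rowLen = μ.rowLen + Pi.single i 1 := by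
  have hcol (κ : YoungDiagram) : κ.transpose.colLen = κ.rowLen := funext κ.colLen_transpose
  rw [← addBox_transpose_iff, addBox_iff_colLen, hcol, hcol]

theorem rowLen_eq_zero_of_colLen_le {μ : YoungDiagram} {i : ℕ} (h : μ.colLen 0 ≤ i) :
    μ.rowLen i = 0 :=
  Nat.eq_zero_of_not_pos fun hi =>
    h.not_gt (YoungDiagram.mem_iff_lt_colLen.1 (YoungDiagram.mem_iff_lt_rowLen.2 hi))

theorem rowLen_rowDiagram (m i : ℕ) : (rowDiagram m).rowLen i = if i = 0 then m else 0 := by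
  refine eq_of_forall_lt_iff fun j => ?_
  rw [← YoungDiagram.mem_iff_lt_rowLen, mem_rowDiagram]
  split_ifs <;> omega

/-- The point `λ + δ` of the chamber that corresponds to a Ferrers diagram `λ` with at most `k`
rows. -/
def toPoint (k : ℕ) (μ : YoungDiagram) : Fin k → ℤ := fun i => μ.rowLen i + delta k i

section toPoint

variable {k : ℕ} {μ ν : YoungDiagram}

theorem toPoint_mem_chamber (k : ℕ) (μ : YoungDiagram) : toPoint k μ ∈ chamber k := by
  refine ⟨fun i j hij => ?_, fun i => ?_⟩
  · have := μ.rowLen_anti i j hij.le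
    have : (i : ℕ) < j := hij
    simp only [toPoint, delta]
    omega
  · simp only [toPoint, delta]
    omega

theorem injOn_toPoint (k : ℕ) : Set.InjOn (toPoint k) {μ | μ.colLen 0 ≤ k} := by
  refine fun μ hμ ν hν h => rowLen_injective (funext fun i => ?_)
  by_cases hi : i < k
  · simpa [toPoint] using congrFun h ⟨i, hi⟩
  · rw [rowLen_eq_zero_of_colLen_le (hμ.trans (not_lt.1 hi)),
      rowLen_eq_zero_of_colLen_le (hν.trans (not_lt.1 hi))]

theorem exists_toPoint_eq {x : Fin k → ℤ} (hx : x ∈ chamber k) :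
    ∃ μ : YoungDiagram, μ.colLen 0 ≤ k ∧ toPoint k μ = x := by
  -- With 0-based indices, `x - δ` is `x i + i - k`; extend it by `0` beyond `k`.
  let y (i : ℕ) : ℤ := if h : i < k then x ⟨i, h⟩ + i else k
  have hanti : Antitone y := by
    refine antitone_nat_of_succ_le fun i => ?_
    rcases lt_trichotomy (i + 1) k with h | h | h
    · have hlt : x ⟨i + 1, h⟩ < x ⟨i, by omega⟩ := hx.1 (Fin.lt_def.2 i.lt_succ_self)
      simp only [y, dif_pos h, dif_pos (i.lt_succ_self.trans h)]
      omega
    · have hpos := hx.2 ⟨i, by omega⟩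
      simp only [y, h, lt_irrefl, dif_neg, not_false_eq_true, dif_pos (show i < k by omega)]
      omega
    · simp only [y, dif_neg (show ¬ i + 1 < k by omega), dif_neg (show ¬ i < k by omega), le_refl]
  have hyk : y k = k := dif_neg (lt_irrefl k)
  obtain ⟨ν, hν⟩ := exists_colLen_eq_iff.2
    ⟨fun i j hij => Int.toNat_le_toNat (sub_le_sub_right (hanti hij) (k : ℤ)), k, by simp [hyk]⟩
  refine ⟨ν.transpose, ?_, funext fun i => ?_⟩
  · by_contra! h
    rw [← YoungDiagram.mem_iff_lt_colLen, YoungDiagram.mem_iff_lt_rowLen,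
      YoungDiagram.rowLen_transpose, hν] at h
    simp [hyk] at h
  · have hle : y k ≤ y i := hanti i.2.le
    simp only [hyk, y, dif_pos i.2] at hle
    rw [toPoint, YoungDiagram.rowLen_transpose, hν]
    simp only [y, dif_pos i.2, delta, Fin.eta] at hle ⊢
    omega

theorem unitStep_toPoint_iff (hμ : μ.colLen 0 ≤ k) (hν : ν.colLen 0 ≤ k) :
    UnitStep (toPoint k μ) (toPoint k ν) ↔ AddBox μ ν := by
  rw [addBox_iff_rowLen]
  have hzero {i : ℕ} (hi : ¬ i < k) : μ.rowLen i = 0 ∧ ν.rowLen i = 0 :=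
    ⟨rowLen_eq_zero_of_colLen_le (hμ.trans (not_lt.1 hi)),
      rowLen_eq_zero_of_colLen_le (hν.trans (not_lt.1 hi))⟩
  constructor
  · rintro ⟨i, h⟩
    refine ⟨i, funext fun r => ?_⟩
    rw [Pi.add_apply, Pi.single_apply]
    by_cases hr : r < k
    · have := congrFun h ⟨r, hr⟩
      simp only [toPoint, Pi.add_apply, Pi.single_apply, Fin.ext_iff] at this
      split_ifs at this ⊢ <;> omega
    · rw [(hzero hr).1, (hzero hr).2, if_neg (by omega), add_zero]
  · rintro ⟨i, h⟩
    have hi : i < k := by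
      by_contra hi
      simpa [hzero hi] using congrFun h i
    refine ⟨⟨i, hi⟩, funext fun r => ?_⟩
    have := congrFun h r
    simp only [toPoint, Pi.add_apply, Pi.single_apply, Fin.ext_iff] at this ⊢
    split_ifs at this ⊢ <;> omega

theorem toPoint_bot : toPoint k ⊥ = delta k := by
  funext i
  simp [toPoint, ← rowDiagram_zero, rowLen_rowDiagram]

theorem isEndpoint_iff {m : ℕ} {x : Fin k → ℤ} :
    IsEndpoint k m x ↔ (rowDiagram m).colLen 0 ≤ k ∧ x = toPoint k (rowDiagram m) := by
  rw [IsEndpoint, colLen_rowDiagram]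
  rcases Nat.eq_zero_or_pos k with rfl | hk
  · simp only [Subsingleton.elim x (delta 0), Subsingleton.elim (toPoint 0 _) (delta 0),
      lt_irrefl, IsEmpty.exists_iff]
    split_ifs <;> simp <;> omega
  · have hpoint : toPoint k (rowDiagram m) = delta k + Pi.single ⟨0, hk⟩ (m : ℤ) := by
      funext i
      simp only [toPoint, rowLen_rowDiagram, Pi.add_apply, Pi.single_apply, Fin.ext_iff]
      split_ifs <;> simp [add_comm]
    have hle : (if 0 < m then 1 else 0) ≤ k := by split_ifs <;> omega
    rw [hpoint, exists_prop_of_true hk, and_iff_right hle, or_iff_right_of_imp]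
    rintro ⟨rfl, rfl⟩
    simp

theorem isEndpoint_toPoint_iff {m : ℕ} (hμ : μ.colLen 0 ≤ k) :
    IsEndpoint k m (toPoint k μ) ↔ μ = rowDiagram m := by
  rw [isEndpoint_iff]
  refine ⟨fun ⟨hm, h⟩ => injOn_toPoint k hμ hm h, ?_⟩
  rintro rfl
  exact ⟨hμ, rfl⟩

end toPoint

theorem isHesitating_toPoint_iff {k n : ℕ} {f : Fin (2 * n + 1) → YoungDiagram}
    (hf : ∀ i, (f i).colLen 0 ≤ k) :
    IsHesitating UnitStep (fun i => toPoint k (f i)) ↔ IsHesitating AddBox f := by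
  simp only [IsHesitating, unitStep_toPoint_iff (hf _) (hf _),
    (injOn_toPoint k).eq_iff (hf _) (hf _)]

theorem toPoint_mem_walks_iff {k n m : ℕ} {f : Fin (2 * n + 1) → YoungDiagram}
    (hf : ∀ i, (f i).colLen 0 ≤ k) :
    (fun i => toPoint k (f i)) ∈ walks k n m ↔ f ∈ tableaux k n m := by
  have hstart : toPoint k (f 0) = delta k ↔ f 0 = ⊥ := by
    rw [← toPoint_bot, (injOn_toPoint k).eq_iff (hf 0)]
    simp [← rowDiagram_zero, colLen_rowDiagram]
  have hend : f (Fin.last _) = rowDiagram m ↔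
      (f (Fin.last (2 * n))).cells = {0} ×ˢ Finset.range m := YoungDiagram.ext_iff
  simp only [walks, tableaux, Set.mem_ofPred_eq, isHesitating_toPoint_iff hf, toPoint_mem_chamber,
    implies_true, true_and, hstart, isEndpoint_toPoint_iff (hf _), hend, hf]

theorem nonempty_tableaux_equiv_walks (k n m : ℕ) : Nonempty (tableaux k n m ≃ walks k n m) := by
  refine ⟨.ofBijective (fun f => ⟨fun i => toPoint k (f.1 i),
    (toPoint_mem_walks_iff f.2.2.2.1).2 f.2⟩) ⟨fun f f' h => ?_, ?_⟩⟩
  · exact Subtype.ext <| funext fun i => injOn_toPoint k (f.2.2.2.1 i) (f'.2.2.2.1 i)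
      (congrFun (congrArg Subtype.val h) i)
  · rintro ⟨w, hw⟩
    choose f hf hfw using fun i => exists_toPoint_eq (hw.2.1 i)
    obtain rfl : (fun i => toPoint k (f i)) = w := funext hfw
    exact ⟨⟨f, (toPoint_mem_walks_iff hf).1 hw⟩, rfl⟩

end Hesitating

theorem theorem1 (k n m : ℕ) :
    Nonempty (Hesitating.tableaux k n m ≃ Hesitating.walks k n m) ∧
      Nonempty (Hesitating.tableaux k n m ≃ Hesitating.openDiagrams k n m) ∧
      Nonempty (Hesitating.walks k n m ≃ Hesitating.openDiagrams k n m) := by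
  obtain ⟨e₁⟩ := Hesitating.nonempty_tableaux_equiv_walks k n m
  obtain ⟨e₂⟩ := Hesitating.nonempty_tableaux_equiv_openDiagrams k n m
  exact ⟨⟨e₁⟩, ⟨e₂⟩, ⟨e₁.symm.trans e₂⟩⟩
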